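/- Let $\lambda(x)>0$ for $x\in\mathbb Z^+=\{0,1,2,\dots\}$, $\mu(0)=0$ and $\mu(x)>0$ for $x\ge 1$, and let $\xi(t)$, $t\ge 0$, be the continuous-time birth-and-death process on $\mathbb Z^+$ with $\xi(0)=0$, with jump rate $\lambda(x)$ for $x\to x+1$ and $\mu(x)$ for $x\to x-1$ (the minimal process, defined up to a possible explosion time). Let $l,m\ge 0$ be real numbers with $l\ne m$, let $y,z$ be slowly varying at infinity (measurable, positive for large arguments, with $\lim_{x\to\infty} y(\beta x)/y(x)=\lim_{x\to\infty} z(\beta x)/z(x)=1$ for every $\beta>0$), put $Y(x)=y(x)x^l$, $Z(x)=z(x)x^m$, $V(x)=\max(Y(x),Z(x))$, and assume $$\lim_{x\to\infty}\frac{\lambda(x)}{Y(x)}=\lim_{x\to\infty}\frac{\mu(x)}{Z(x)}=1 .$$ Let $\varphi:(0,\infty)\to(0,\infty)$ satisfy $$\lim_{T\to\infty}\varphi(T)=\infty,\qquad \lim_{T\to\infty}\frac{\varphi(T)\ln\varphi(T)}{T\,V(\varphi(T))}=0,$$ and set $\xi_{\varphi,T}(t)=\xi(tT)/\varphi(T)$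 for $0\le t\le 1$. **Theorem 2.1.** The family $\xi_{\varphi,T}$ satisfies the local large deviation principle with normalization $\psi(T)=T\,V(\varphi(T))$ and rate function $I(f)=\int_0^1 f(t)^{\max(l,m)}\,dt$ (which does not depend on $\varphi$). That is, for every continuous $f:[0,1]\to\mathbb R$ with $f(0)=0$ and $f(t)>0$ for $0<t\le 1$, $$\lim_{\varepsilon\to 0^+}\limsup_{T\to\infty}\frac{1}{\psi(T)}\ln\mathbf P\big(\xi_{\varphi,T}\in U_\varepsilon(f)\big)=\lim_{\varepsilon\to 0^+}\liminf_{T\to\infty}\frac{1}{\psi(T)}\ln\mathbf P\big(\xi_{\varphi,T}\in U_\varepsilon(f)\big)=-I(f),$$ where $\ln 0=-\infty$ and $\{\xi_{\varphi,T}\in U_\varepsilon(f)\}$ is the event that $\xi$ does not explode during $[0,T]$ and $\sup_{0\le t\le 1}|\xi_{\varphi,T}(t)-f(t)|<\varepsilon$. -/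

import Mathlib

open Filter Topology MeasureTheory Set

noncomputable section

namespace BirthDeath

/-- Slow variation at infinity in Karamata's sense: `a` is measurable, positive for large
arguments, and `a (β x) / a x → 1` as `x → ∞` for every `β > 0`. -/
structure SlowlyVarying (a : ℝ → ℝ) : Prop where
  measurable : Measurable a
  eventually_pos : ∀ᶠ x in atTop, 0 < a x
  tendsto_ratio : ∀ β : ℝ, 0 < β → Tendsto (fun x => a (β * x) / a x) atTop (𝓝 1)

/-- The function `x ↦ a(x) x ^ p`. -/
def regVar (a : ℝ → ℝ) (p : ℝ) (x : ℝ) : ℝ := a x * x ^ p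

/-- One-step transition probabilities of the embedded jump chain of the birth-and-death process
with birth rates `lam` and death rates `mu`. -/
def jumpProb (lam mu : ℕ → ℝ) (x x' : ℕ) : ℝ :=
  if x' = x + 1 then lam x / (lam x + mu x)
  else if x = x' + 1 then mu x / (lam x + mu x)
  else 0

/-- The time of the `n`-th jump, given the sequence `S` of holding times. -/
def jumpTime (S : ℕ → ℝ) (n : ℕ) : ℝ := ∑ i ∈ Finset.range n, S i

/-- `ξ` is a (minimal) continuous-time birth-and-death process on `ℕ` started at `0`, with birth
rates `lam` and death rates `mu`, in its jump chain / holding time description: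

* the embedded chain `X 0, X 1, …` starts at `0` and is Markov with transition probabilities
  `jumpProb lam mu`; given this chain, the holding times `S 0, S 1, …` are independent, and
  `S i` is exponential with parameter `lam (X i) + mu (X i)` (`law` spells out the joint law);
* almost surely, `ξ t = X n` between the `n`-th and the `(n+1)`-st jump, and from the explosion
  time on (if there is one) `ξ` stays in the extra state `⊤`. -/
def IsBirthDeathProcess {Ω : Type*} [MeasurableSpace Ω] (P : Measure Ω)
    (lam mu : ℕ → ℝ) (ξ : ℝ → Ω → ℕ∞) : Prop :=
  ∃ (X : ℕ → Ω → ℕ) (S : ℕ → Ω → ℝ),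
    (∀ n, Measurable (X n)) ∧ (∀ n, Measurable (S n)) ∧
    -- law
    (∀ (n : ℕ) (x : ℕ → ℕ) (s : ℕ → ℝ), (∀ i, 0 ≤ s i) →
      P {ω | ∀ i ≤ n, X i ω = x i ∧ s i < S i ω} =
        ENNReal.ofReal ((if x 0 = 0 then 1 else 0) *
          (∏ i ∈ Finset.range n, jumpProb lam mu (x i) (x (i + 1))) *
          ∏ i ∈ Finset.range (n + 1), Real.exp (-((lam (x i) + mu (x i)) * s i)))) ∧
    -- trajectories
    (∀ᵐ ω ∂P,
      (∀ (n : ℕ) (t : ℝ), jumpTime (fun i => S i ω) n ≤ t →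
        t < jumpTime (fun i => S i ω) (n + 1) → ξ t ω = (X n ω : ℕ∞)) ∧
      (∀ t : ℝ, (∀ n, jumpTime (fun i => S i ω) n ≤ t) → ξ t ω = ⊤))

/-- The event that the scaled process `t ↦ ξ (t T) / φ T`, `0 ≤ t ≤ 1`, does not explode and lies
in the `ε`-neighbourhood of `f` for the uniform distance on `[0,1]`. -/
def tubeEvent {Ω : Type*} (ξ : ℝ → Ω → ℕ∞) (φ : ℝ → ℝ) (T : ℝ) (f : ℝ → ℝ) (ε : ℝ) : Set Ω :=
  {ω | (∀ t ∈ Icc (0 : ℝ) 1, ξ (t * T) ω ≠ ⊤) ∧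
    (⨆ t ∈ Icc (0 : ℝ) 1, edist (((ξ (t * T) ω).toNat : ℝ) / φ T) (f t)) < ENNReal.ofReal ε}

/-- The family of scaled processes `ξ (t T) / φ T` satisfies the local large deviation principle
on the set `F` of functions, with normalization `ψ` and rate function `I`. Logarithms of
probabilities are extended-real-valued, with `log 0 = -∞`. -/
def SatisfiesLLDP {Ω : Type*} [MeasurableSpace Ω] (P : Measure Ω) (ξ : ℝ → Ω → ℕ∞)
    (φ ψ : ℝ → ℝ) (I : (ℝ → ℝ) → ℝ) (F : Set (ℝ → ℝ)) : Prop :=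
  ∀ f ∈ F,
    Tendsto (fun ε : ℝ => limsup (fun T : ℝ =>
        ENNReal.log (P (tubeEvent ξ φ T f ε)) / ((ψ T : ℝ) : EReal)) atTop)
      (𝓝[>] 0) (𝓝 ((-(I f) : ℝ) : EReal)) ∧
    Tendsto (fun ε : ℝ => liminf (fun T : ℝ =>
        ENNReal.log (P (tubeEvent ξ φ T f ε)) / ((ψ T : ℝ) : EReal)) atTop)
      (𝓝[>] 0) (𝓝 ((-(I f) : ℝ) : EReal))

/-- Functions continuous on `[0,1]`, vanishing at `0` and positive on `(0,1]`. -/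
def pathSet : Set (ℝ → ℝ) :=
  {f | ContinuousOn f (Icc 0 1) ∧ f 0 = 0 ∧ ∀ t ∈ Ioc (0 : ℝ) 1, 0 < f t}

end BirthDeath

end

/-! Put p = max l m and q = λ + μ. Since l ≠ m, one of the two rates is negligible against the other
at infinity, so q is regularly varying of index p > 0 and q(n) / V(x) is close to (n / x) ^ p
uniformly for n ≤ b x. To follow f φ(T), the process may not drift away in the dominant direction,
and jumps in the opposite direction are too rare to compensate cheaply. The cheapest strategy is to
jump hardly at all, which costs the exponential of minus the integral of q(ξ) over [0, T], to
leading order T V(φ(T)) ∫ f ^ p.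

Upper bound. Formally, ζ ^ ξ(t) exp(∫₀ᵗ `tilt` (ξ s) ds) is a martingale. With ζ small if births
dominate and large if deaths dominate, `tilt` is at least (1 - η) q up to an additive constant
(`total_rate_regVar`). In the tube ξ ≤ K with K = O(φ(T)), so the factor ζ ^ ξ(T) costs only
exp(O(φ(T))). The estimate is carried out path by path on the jump chain, by Chernoff's bound on the
holding times; an extra factor exp T makes the sum over the number of jumps a geometric series
(`measure_costEvent_le`). All these losses are o(T V(φ(T))).

Lower bound. Fix one nearest-neighbour path with N = O(φ(T)) steps near f φ(T), and require each
holding time to lie slightly above T / N. The survival factors multiply to exp(-(T / N) Σ q), a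
Riemann sum of the cost. Each jump and each window costs a further power of φ(T), that is
exp(-O(φ(T) log φ(T))) altogether; this is where the full growth hypothesis on φ is used.

The uniformity in the rates comes from `eventually_abs_translate_sub_le` and Potter's bounds,
through `rate_uniform`. -/

namespace BirthDeath

open ProbabilityTheory

/-! ### Regular variation: uniform convergence and Potter's bounds. -/

/-- Karamata's uniform convergence theorem, in additive form. -/
theorem eventually_abs_translate_sub_le {h : ℝ → ℝ} (hm : Measurable h)
    (hh : ∀ t, Tendsto (fun x => h (x + t) - h x) atTop (𝓝 0)) {ε : ℝ} (hε : 0 < ε) :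
    ∀ᶠ x in atTop, ∀ t ∈ Icc (0 : ℝ) 1, |h (x + t) - h x| ≤ ε := by
  -- Truncation at 1 gives a dominating function without any local bound on h, so F → 0 follows from
  -- pointwise convergence alone.
  set F : ℝ → ℝ := fun x => ∫ s in (0 : ℝ)..2, min 1 |h (x + s) - h x| with hF
  have hmeas : ∀ x c : ℝ, Measurable fun s => min 1 |h (x + s) - c| := by
    intro x c
    have : Measurable fun s => h (x + s) - c :=
      (hm.comp (measurable_const.add measurable_id)).sub measurable_const
    simpa using measurable_const.min (this.norm)
  have hint : ∀ x c a b : ℝ, IntervalIntegrable (fun s => min 1 |h (x + s) - c|) volume a b := by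
    intro x c a b
    refine (intervalIntegrable_const (c := (1 : ℝ))).mono_fun
      (hmeas x c).aestronglyMeasurable (ae_of_all _ fun s => ?_)
    simp only [Real.norm_eq_abs, abs_one]
    rw [abs_of_nonneg (le_min zero_le_one (abs_nonneg _))]
    exact min_le_left _ _
  have hF0 : Tendsto F atTop (𝓝 0) := by
    have : (0 : ℝ) = ∫ s in (0 : ℝ)..2, (0 : ℝ) := by simp
    rw [this]
    refine intervalIntegral.tendsto_integral_filter_of_dominated_convergence (fun _ => (1 : ℝ))
      (Eventually.of_forall fun x => (hmeas x _).aestronglyMeasurable)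
      (Eventually.of_forall fun x => ae_of_all _ fun s _ => ?_) intervalIntegrable_const
      (ae_of_all _ fun s _ => ?_)
    · simp only [Real.norm_eq_abs]
      rw [abs_of_nonneg (le_min zero_le_one (abs_nonneg _))]
      exact min_le_left _ _
    · have h1 := ((hh s).abs)
      have h2 : Tendsto (fun x => min 1 |h (x + s) - h x|) atTop (𝓝 (min 1 |0|)) :=
        tendsto_const_nhds.min h1
      simpa using h2
  have hε' : 0 < min ε (1 / 2) / 2 := by positivity
  obtain ⟨x0, hx0⟩ := eventually_atTop.1 (hF0.eventually (gt_mem_nhds hε'))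
  filter_upwards [eventually_ge_atTop x0] with x hx t ht
  have h1 := hx0 x hx
  have h2 := hx0 (x + t) (by linarith [ht.1])
  have hnn : ∀ y c s : ℝ, 0 ≤ min 1 |h (y + s) - c| := fun y c s =>
    le_min zero_le_one (abs_nonneg _)
  -- Compare both values with h (x + u) and average over u in [1, 2]: both u and u - t then lie in
  -- [0, 2], so each term is controlled by F, at x or at x + t.
  have key : min 1 |h (x + t) - h x| ≤ F x + F (x + t) := by
    have e1 : min 1 |h (x + t) - h x| = ∫ u in (1 : ℝ)..2, min 1 |h (x + t) - h x| := by
      rw [intervalIntegral.integral_const]; norm_num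
    have e2 : (∫ u in (1 : ℝ)..2, min 1 |h (x + t) - h x|) ≤
        ∫ u in (1 : ℝ)..2, (min 1 |h (x + u) - h x| + min 1 |h (x + u) - h (x + t)|) := by
      refine intervalIntegral.integral_mono_on (by norm_num) intervalIntegrable_const
        ((hint _ _ _ _).add (hint _ _ _ _)) fun u _ => ?_
      have := abs_sub_le (h (x + t)) (h (x + u)) (h x)
      rw [abs_sub_comm (h (x + t)) (h (x + u))] at this
      rcases le_total 1 |h (x + u) - h x| with ha | ha
      · rw [min_eq_left ha]; linarith [min_le_left 1 |h (x + t) - h x|, hnn x (h (x + t)) u]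
      rcases le_total 1 |h (x + u) - h (x + t)| with hb | hb
      · rw [min_eq_left hb]; linarith [min_le_left 1 |h (x + t) - h x|, hnn x (h x) u]
      rw [min_eq_right ha, min_eq_right hb]
      linarith [min_le_right 1 |h (x + t) - h x|]
    rw [intervalIntegral.integral_add (hint _ _ _ _) (hint _ _ _ _)] at e2
    have e3 : (∫ u in (1 : ℝ)..2, min 1 |h (x + u) - h x|) ≤ F x :=
      intervalIntegral.integral_mono_interval (by norm_num) (by norm_num) le_rfl
        (ae_of_all _ fun s => hnn _ _ _) (hint _ _ _ _)
    have e4 : (∫ u in (1 : ℝ)..2, min 1 |h (x + u) - h (x + t)|) ≤ F (x + t) := by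
      have : (∫ u in (1 : ℝ)..2, min 1 |h (x + u) - h (x + t)|) =
          ∫ s in (1 - t)..(2 - t), min 1 |h (x + t + s) - h (x + t)| := by
        rw [← intervalIntegral.integral_comp_sub_right
          (fun s => min 1 |h (x + t + s) - h (x + t)|) t]
        refine intervalIntegral.integral_congr fun u _ => ?_
        congr 4; ring
      rw [this]
      exact intervalIntegral.integral_mono_interval (by linarith [ht.2]) (by linarith)
        (by linarith [ht.1]) (ae_of_all _ fun s => hnn _ _ _) (hint _ _ _ _)
    linarith
  -- The bound is below 1, so the truncation is inactive.
  have hlt : min 1 |h (x + t) - h x| < min ε (1 / 2) := by linarith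
  have h3 : min ε (1 / 2) ≤ 1 / 2 := min_le_right _ _
  rcases min_lt_iff.1 hlt with h4 | h4
  · linarith
  · exact (h4.trans_le (min_le_left _ _)).le

/-- Increments of size at most `ε` over unit steps accumulate at most linearly. -/
theorem abs_sub_le_of_unit_steps {h : ℝ → ℝ} {ε x0 : ℝ} (hε : 0 ≤ ε)
    (hstep : ∀ x, x0 ≤ x → ∀ t ∈ Icc (0 : ℝ) 1, |h (x + t) - h x| ≤ ε)
    {x y : ℝ} (hx : x0 ≤ x) (hy : x0 ≤ y) : |h x - h y| ≤ ε * (|x - y| + 1) := by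
  have main : ∀ x, x0 ≤ x → ∀ n : ℕ, ∀ s ∈ Icc (0 : ℝ) 1,
      |h (x + n + s) - h x| ≤ ε * (n + 1) := by
    intro x hx n
    induction n with
    | zero => intro s hs; simpa using hstep x hx s hs
    | succ n ih =>
      intro s hs
      have h1 := ih 1 ⟨zero_le_one, le_rfl⟩
      have h2 := hstep (x + n + 1) (by linarith [n.cast_nonneg (α := ℝ)]) s hs
      have h3 := abs_sub_le (h (x + n + 1 + s)) (h (x + n + 1)) (h x)
      push_cast
      rw [show x + (n + 1) + s = x + n + 1 + s by ring]
      linarith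
  have main2 : ∀ x y, x0 ≤ y → y ≤ x → |h x - h y| ≤ ε * (|x - y| + 1) := by
    intro x y hy hxy
    have h1 := main y hy ⌊x - y⌋₊ (x - y - ⌊x - y⌋₊)
      ⟨by linarith [Nat.floor_le (sub_nonneg.2 hxy)], by linarith [Nat.lt_floor_add_one (x - y)]⟩
    rw [show y + (⌊x - y⌋₊ : ℝ) + (x - y - ⌊x - y⌋₊) = x by ring] at h1
    refine h1.trans (mul_le_mul_of_nonneg_left ?_ hε)
    rw [abs_of_nonneg (sub_nonneg.2 hxy)]
    linarith [Nat.floor_le (sub_nonneg.2 hxy)]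
  rcases le_total y x with hxy | hxy
  · exact main2 x y hy hxy
  · rw [abs_sub_comm, abs_sub_comm x y]; exact main2 y x hx hxy

/-- Potter's bounds for slowly varying functions, in logarithmic form. -/
theorem SlowlyVarying.potter {a : ℝ → ℝ} (ha : SlowlyVarying a) {ε : ℝ} (hε : 0 < ε) :
    ∃ x0 : ℝ, 1 ≤ x0 ∧ (∀ x, x0 ≤ x → 0 < a x) ∧ ∀ x y, x0 ≤ x → x0 ≤ y →
      |Real.log (a x) - Real.log (a y)| ≤ ε * (|Real.log x - Real.log y| + 1) := by
  set h : ℝ → ℝ := fun x => Real.log (a (Real.exp x)) with hh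
  have hm : Measurable h := Real.measurable_log.comp (ha.measurable.comp Real.measurable_exp)
  have ht : ∀ t, Tendsto (fun x => h (x + t) - h x) atTop (𝓝 0) := by
    intro t
    have h1 := (ha.tendsto_ratio (Real.exp t) (Real.exp_pos t)).comp Real.tendsto_exp_atTop
    have h2 := (Real.continuousAt_log one_ne_zero).tendsto.comp h1
    rw [Real.log_one] at h2
    refine h2.congr' ?_
    have hp := Real.tendsto_exp_atTop.eventually ha.eventually_pos
    have hp2 := (tendsto_atTop_add_const_right atTop t tendsto_id).eventually hp
    filter_upwards [hp, hp2] with x hx hx2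
    simp only [Function.comp, hh, id] at *
    rw [← Real.exp_add, add_comm t x, Real.log_div hx2.ne' hx.ne']
  obtain ⟨u0, hu0⟩ := eventually_atTop.1 (eventually_abs_translate_sub_le hm ht hε)
  obtain ⟨v0, hv0⟩ := eventually_atTop.1 ha.eventually_pos
  refine ⟨max 1 (max (Real.exp u0) v0), le_max_left _ _, fun x hx => hv0 x ?_, ?_⟩
  · exact (le_max_right _ _).trans ((le_max_right _ _).trans hx)
  have hlog : ∀ x, max 1 (max (Real.exp u0) v0) ≤ x → 0 < x ∧ u0 ≤ Real.log x := by
    intro x hx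
    have h1 : (1 : ℝ) ≤ x := (le_max_left _ _).trans hx
    have h2 : Real.exp u0 ≤ x := (le_max_left _ _).trans ((le_max_right _ _).trans hx)
    exact ⟨by linarith, (Real.le_log_iff_exp_le (by linarith)).2 h2⟩
  intro x y hx hy
  obtain ⟨hx1, hx2⟩ := hlog x hx
  obtain ⟨hy1, hy2⟩ := hlog y hy
  have := abs_sub_le_of_unit_steps hε.le hu0 hx2 hy2
  simpa only [hh, Real.exp_log hx1, Real.exp_log hy1] using this

theorem log_regVar {a : ℝ → ℝ} {p x : ℝ} (hx : 0 < x) (ha : 0 < a x) :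
    Real.log (regVar a p x) = Real.log (a x) + p * Real.log x := by
  rw [regVar, Real.log_mul ha.ne' (Real.rpow_pos_of_pos hx p).ne', Real.log_rpow hx]

theorem SlowlyVarying.regVar_pos {a : ℝ → ℝ} (ha : SlowlyVarying a) (p : ℝ) :
    ∀ᶠ x in atTop, 0 < regVar a p x := by
  filter_upwards [ha.eventually_pos, eventually_gt_atTop 0] with x hx h0
  exact mul_pos hx (Real.rpow_pos_of_pos h0 p)

theorem SlowlyVarying.potter_regVar {a : ℝ → ℝ} (ha : SlowlyVarying a) (p : ℝ) {ε : ℝ}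
    (hε : 0 < ε) :
    ∃ x0 : ℝ, 1 ≤ x0 ∧ (∀ x, x0 ≤ x → 0 < regVar a p x) ∧ ∀ x y, x0 ≤ x → x0 ≤ y →
      |Real.log (regVar a p x) - Real.log (regVar a p y) - p * (Real.log x - Real.log y)|
        ≤ ε * (|Real.log x - Real.log y| + 1) := by
  obtain ⟨x0, h1, hpos, hx0⟩ := ha.potter hε
  refine ⟨x0, h1, fun x hx =>
    mul_pos (hpos x hx) (Real.rpow_pos_of_pos (by linarith) p), fun x y hx hy => ?_⟩
  rw [log_regVar (by linarith) (hpos x hx), log_regVar (by linarith) (hpos y hy)]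
  convert hx0 x y hx hy using 2
  ring

theorem log_rate_sub_tendsto {a : ℝ → ℝ} (ha : SlowlyVarying a) {p : ℝ} {r : ℕ → ℝ}
    (hr : Tendsto (fun n : ℕ => r n / regVar a p n) atTop (𝓝 1)) :
    Tendsto (fun n : ℕ => Real.log (r n) - Real.log (regVar a p n)) atTop (𝓝 0) := by
  have h2 := (Real.continuousAt_log one_ne_zero).tendsto.comp hr
  rw [Real.log_one] at h2
  refine h2.congr' ?_
  filter_upwards [tendsto_natCast_atTop_atTop.eventually (ha.regVar_pos p),
    hr.eventually (lt_mem_nhds zero_lt_one)] with n hn hn2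
  have : 0 < r n := by
    have := mul_pos hn2 hn
    rwa [div_mul_cancel₀ _ hn.ne'] at this
  simp only [Function.comp]
  rw [Real.log_div this.ne' hn.ne']

/-- The rate differs from its regularly varying equivalent by o(1) in logarithm. The term `+ 1` in
Potter's bound absorbs this error, half of ε being kept for it. -/
theorem rate_potter {a : ℝ → ℝ} (ha : SlowlyVarying a) {p : ℝ} {r : ℕ → ℝ}
    (hr : Tendsto (fun n : ℕ => r n / regVar a p n) atTop (𝓝 1)) {ε : ℝ} (hε : 0 < ε) :
    ∃ x0 : ℝ, 1 ≤ x0 ∧ (∀ x, x0 ≤ x → 0 < regVar a p x) ∧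
      ∀ (n : ℕ) (x : ℝ), x0 ≤ n → x0 ≤ x →
      |Real.log (r n) - Real.log (regVar a p x) - p * (Real.log n - Real.log x)|
        ≤ ε * (|Real.log n - Real.log x| + 1) := by
  obtain ⟨x0, h1, hpos, hx0⟩ := ha.potter_regVar p (half_pos hε)
  have h2 := (log_rate_sub_tendsto ha hr).abs.eventually
    (gt_mem_nhds (show |(0 : ℝ)| < ε / 2 by rw [abs_zero]; linarith))
  obtain ⟨n0, hn0⟩ := eventually_atTop.1 h2
  refine ⟨max x0 n0, h1.trans (le_max_left _ _), fun x hx => hpos x ((le_max_left _ _).trans hx),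
    fun n x hn hx => ?_⟩
  have h3 := hx0 n x ((le_max_left _ _).trans hn) ((le_max_left _ _).trans hx)
  have h4 := hn0 n (by exact_mod_cast (le_max_right _ _).trans hn)
  have h5 := abs_nonneg (Real.log n - Real.log x)
  rw [abs_le] at h3 ⊢
  rw [abs_lt] at h4
  constructor <;> nlinarith [h3.1, h3.2, h4.1, h4.2]

/-- Potter's bound with slope p / 2 leaves logarithmic growth of slope at least p / 2. -/
theorem SlowlyVarying.regVar_tendsto_atTop {a : ℝ → ℝ} (ha : SlowlyVarying a) {p : ℝ}
    (hp : 0 < p) : Tendsto (regVar a p) atTop atTop := by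
  obtain ⟨x0, h1, hpos, hx0⟩ := ha.potter_regVar p (half_pos hp)
  have h2 : Tendsto (fun x => Real.log (regVar a p x)) atTop atTop := by
    have h3 : Tendsto (fun x => (p / 2) * Real.log x +
        (Real.log (regVar a p x0) - p / 2 * Real.log x0 - p / 2)) atTop atTop :=
      tendsto_atTop_add_const_right _ _ (Real.tendsto_log_atTop.const_mul_atTop (half_pos hp))
    refine tendsto_atTop_mono' _ ?_ h3
    filter_upwards [eventually_ge_atTop x0] with x hx
    have h4 := hx0 x x0 hx le_rfl
    have h5 : Real.log x0 ≤ Real.log x := Real.log_le_log (by linarith) hx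
    rw [abs_of_nonneg (sub_nonneg.2 h5)] at h4
    have := (abs_le.1 h4).1
    nlinarith
  have h3 := Real.tendsto_exp_atTop.comp h2
  refine h3.congr' ?_
  filter_upwards [ha.regVar_pos p] with x hx
  simp only [Function.comp, Real.exp_log hx]

theorem SlowlyVarying.abs_log_regVar_le {a : ℝ → ℝ} (ha : SlowlyVarying a) (p : ℝ) :
    ∃ K : ℝ, 0 ≤ K ∧ ∀ᶠ x in atTop, |Real.log (regVar a p x)| ≤ K * Real.log x := by
  obtain ⟨x0, h1, hpos, hx0⟩ := ha.potter_regVar p zero_lt_one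
  refine ⟨|Real.log (regVar a p x0)| + 1 + |p| + 1, by positivity, ?_⟩
  filter_upwards [eventually_ge_atTop x0, eventually_ge_atTop (Real.exp 1)] with x hx hxe
  have h4 := hx0 x x0 hx le_rfl
  have h5 : Real.log x0 ≤ Real.log x := Real.log_le_log (by linarith) hx
  have h6 : 1 ≤ Real.log x := by
    rw [Real.le_log_iff_exp_le (by linarith)]; exact hxe
  have h7 : 0 ≤ Real.log x0 := Real.log_nonneg h1
  rw [abs_of_nonneg (sub_nonneg.2 h5)] at h4
  have h8 : |p * (Real.log x - Real.log x0)| ≤ |p| * Real.log x := by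
    rw [abs_mul, abs_of_nonneg (sub_nonneg.2 h5)]
    exact mul_le_mul_of_nonneg_left (by linarith) (abs_nonneg _)
  have h9 : |Real.log (regVar a p x0)| ≤ |Real.log (regVar a p x0)| * Real.log x :=
    le_mul_of_one_le_right (abs_nonneg _) h6
  have h10 := abs_add_le (Real.log (regVar a p x) - Real.log (regVar a p x0) -
    p * (Real.log x - Real.log x0)) (Real.log (regVar a p x0) + p * (Real.log x - Real.log x0))
  have h11 := abs_add_le (Real.log (regVar a p x0)) (p * (Real.log x - Real.log x0))
  rw [show Real.log (regVar a p x) - Real.log (regVar a p x0) -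
    p * (Real.log x - Real.log x0) + (Real.log (regVar a p x0) +
      p * (Real.log x - Real.log x0)) = Real.log (regVar a p x) by ring] at h10
  nlinarith

/-- A real sequence is bounded above on an initial segment. -/
theorem exists_bound_of_lt (u : ℕ → ℝ) (n : ℕ) : ∃ C : ℝ, 0 ≤ C ∧ ∀ k < n, u k ≤ C := by
  refine ⟨∑ i ∈ Finset.range n, |u i|, Finset.sum_nonneg fun i _ => abs_nonneg _, fun k hk => ?_⟩
  exact (le_abs_self _).trans (Finset.single_le_sum (f := fun i => |u i|)
    (fun i _ => abs_nonneg _) (Finset.mem_range.2 hk))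

theorem exists_bound_of_eventually_le {u v : ℕ → ℝ} (h : ∀ᶠ n in atTop, u n ≤ v n) :
    ∃ C : ℝ, 0 ≤ C ∧ ∀ n, u n ≤ v n + C := by
  obtain ⟨n0, hn0⟩ := eventually_atTop.1 h
  obtain ⟨C, hC, hC'⟩ := exists_bound_of_lt (fun n => u n - v n) n0
  refine ⟨C, hC, fun n => ?_⟩
  rcases lt_or_ge n n0 with hn | hn
  · linarith [hC' n hn]
  · linarith [hn0 n hn]

/-- Polynomial control at every state, needed to price single jumps. The shift by 2 keeps the
right-hand logarithm at least log 2, so that the finitely many exceptional states go into the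
constant. No positivity is needed: a vanishing rate has `Real.log` equal to 0. -/
theorem abs_log_rate_le {a : ℝ → ℝ} (ha : SlowlyVarying a) {p : ℝ} {r : ℕ → ℝ}
    (hr : Tendsto (fun n : ℕ => r n / regVar a p n) atTop (𝓝 1)) :
    ∃ K : ℝ, 0 ≤ K ∧ ∀ n : ℕ, |Real.log (r n)| ≤ K * Real.log (n + 2) := by
  obtain ⟨K, hK, hK'⟩ := ha.abs_log_regVar_le p
  have h2 := (log_rate_sub_tendsto ha hr).abs.eventually
    (gt_mem_nhds (show |(0 : ℝ)| < 1 by simp))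
  have h3 : ∀ᶠ n : ℕ in atTop, |Real.log (r n)| ≤ K * Real.log (n + 2) + 1 := by
    filter_upwards [h2, tendsto_natCast_atTop_atTop.eventually hK', eventually_gt_atTop 0]
      with n hn hn2 hn0
    have h4 : Real.log n ≤ Real.log (n + 2) :=
      Real.log_le_log (by exact_mod_cast hn0) (by linarith)
    have h5 := abs_sub_abs_le_abs_sub (Real.log (r n)) (Real.log (regVar a p n))
    nlinarith
  obtain ⟨C, hC, hC'⟩ := exists_bound_of_eventually_le h3
  have hl2 : 0 < Real.log 2 := Real.log_pos one_lt_two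
  refine ⟨K + (1 + C) / Real.log 2, by positivity, fun n => (hC' n).trans ?_⟩
  have h6 : Real.log 2 ≤ Real.log (n + 2) :=
    Real.log_le_log two_pos (by linarith [n.cast_nonneg (α := ℝ)])
  have h7 : 1 + C ≤ (1 + C) / Real.log 2 * Real.log (n + 2) := by
    rw [div_mul_eq_mul_div, le_div_iff₀ hl2]
    exact mul_le_mul_of_nonneg_left h6 (by linarith)
  linarith

/-- Potter's bounds with slope (p' - p) / 4 for each function use up half of the gap between the
exponents; the other half drives the logarithm of the ratio to -∞. -/
theorem regVar_ratio_tendsto_zero {a b : ℝ → ℝ} (ha : SlowlyVarying a) (hb : SlowlyVarying b)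
    {p p' : ℝ} (hp : p < p') : Tendsto (fun x => regVar a p x / regVar b p' x) atTop (𝓝 0) := by
  have hε : 0 < (p' - p) / 4 := by linarith
  obtain ⟨x0, h1, hpos, hx0⟩ := ha.potter_regVar p hε
  obtain ⟨x1, h1', hpos', hx1⟩ := hb.potter_regVar p' hε
  set X := max x0 x1
  have h2 : Tendsto (fun x => Real.log (regVar a p x) - Real.log (regVar b p' x)) atTop atBot := by
    have h3 : Tendsto (fun x => -((p' - p) / 2 * Real.log x) +
        (Real.log (regVar a p X) - Real.log (regVar b p' X) + (p' - p) / 2 * Real.log X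
          + (p' - p) / 2)) atTop atBot :=
      tendsto_atBot_add_const_right _ _ (tendsto_neg_atTop_atBot.comp
        (Real.tendsto_log_atTop.const_mul_atTop (by linarith)))
    refine tendsto_atBot_mono' _ ?_ h3
    filter_upwards [eventually_ge_atTop X] with x hx
    have h4 := hx0 x X ((le_max_left _ _).trans hx) (le_max_left _ _)
    have h4' := hx1 x X ((le_max_right _ _).trans hx) (le_max_right _ _)
    have hX : 1 ≤ X := h1.trans (le_max_left _ _)
    have h5 : Real.log X ≤ Real.log x := Real.log_le_log (by linarith) hx
    rw [abs_of_nonneg (sub_nonneg.2 h5)] at h4 h4'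
    have := (abs_le.1 h4).2
    have := (abs_le.1 h4').1
    nlinarith
  refine (Real.tendsto_exp_atBot.comp h2).congr' ?_
  filter_upwards [ha.regVar_pos p, hb.regVar_pos p'] with x hx hx'
  simp only [Function.comp, Real.exp_sub, Real.exp_log hx, Real.exp_log hx']

/-! ### Uniform scaling of the rates and dominance of one of them. -/

/-- The rates, rescaled by a regularly varying function of positive index, converge to a power
uniformly on bounded sets, including a neighbourhood of `0`. -/
theorem rate_uniform {a : ℝ → ℝ} (ha : SlowlyVarying a) {p : ℝ} (hp : 0 < p) {r : ℕ → ℝ}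
    (hrpos : ∀ n, 0 < r n) (hr : Tendsto (fun n : ℕ => r n / regVar a p n) atTop (𝓝 1))
    {δ : ℝ} (hδ : 0 < δ) (b : ℝ) :
    ∀ᶠ x in atTop, ∀ n : ℕ, (n : ℝ) ≤ b * x →
      |r n / regVar a p x - (n / x) ^ p| ≤ δ := by
  -- a threshold below which both terms are small
  obtain ⟨u0, hu0, hu1, hu2⟩ : ∃ u0 : ℝ, 0 < u0 ∧ u0 < 1 ∧ u0 ^ (p / 2) * Real.exp 1 ≤ δ := by
    have h1 : Tendsto (fun u : ℝ => u ^ (p / 2) * Real.exp 1) (𝓝[>] 0) (𝓝 0) := by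
      have : ContinuousAt (fun u : ℝ => u ^ (p / 2) * Real.exp 1) 0 :=
        (Real.continuousAt_rpow_const 0 (p / 2) (Or.inr (by linarith))).mul_const _
      have h2 := this.tendsto
      rw [Real.zero_rpow (by linarith), zero_mul] at h2
      exact h2.mono_left nhdsWithin_le_nhds
    obtain ⟨u, hu⟩ := ((h1.eventually (gt_mem_nhds hδ)).and (Ioo_mem_nhdsGT one_pos)).exists
    exact ⟨u, hu.2.1, hu.2.2, hu.1.le⟩
  set B := max b 1 with hB
  have hB1 : 1 ≤ B := le_max_right _ _
  set Λ := |Real.log u0| + |Real.log B| + 1 with hΛ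
  have hΛ1 : 1 ≤ Λ := by rw [hΛ]; linarith [abs_nonneg (Real.log u0), abs_nonneg (Real.log B)]
  -- a precision
  obtain ⟨θ, hθ, hθ1, hθ2⟩ : ∃ θ : ℝ, 0 < θ ∧ θ ≤ 1 ∧ B ^ p * (2 * θ) ≤ δ := by
    have hBp : 0 < B ^ p := Real.rpow_pos_of_pos (by linarith) p
    refine ⟨min 1 (δ / (2 * B ^ p)), lt_min one_pos (by positivity), min_le_left _ _, ?_⟩
    have := min_le_right 1 (δ / (2 * B ^ p))
    calc B ^ p * (2 * min 1 (δ / (2 * B ^ p))) ≤ B ^ p * (2 * (δ / (2 * B ^ p))) := by gcongr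
      _ = δ := by field_simp
  -- The first bound serves ratios n / x in [u0, B], where |log (n / x)| + 1 ≤ Λ; the other two
  -- serve ratios below u0, where half of the exponent p is sacrificed.
  set ε := min (θ / Λ) (min (p / 2) 1) with hε
  have hεpos : 0 < ε := lt_min (by positivity) (lt_min (by linarith) one_pos)
  have hε1 : ε * Λ ≤ θ := by
    have : ε ≤ θ / Λ := min_le_left _ _
    rwa [le_div_iff₀ (by linarith)] at this
  have hε2 : ε ≤ p / 2 := (min_le_right _ _).trans (min_le_left _ _)
  have hε3 : ε ≤ 1 := (min_le_right _ _).trans (min_le_right _ _)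
  obtain ⟨x0, hx01, hpos, hx0⟩ := rate_potter ha hr hεpos
  obtain ⟨C, hC, hC'⟩ := exists_bound_of_lt r ⌈x0⌉₊
  have hVinf := ha.regVar_tendsto_atTop hp
  have hsmall : ∀ᶠ x : ℝ in atTop, (x0 / x) ^ p ≤ δ := by
    have h1 : Tendsto (fun x : ℝ => (x0 / x) ^ p) atTop (𝓝 0) := by
      have h2 : Tendsto (fun x : ℝ => x0 / x) atTop (𝓝 0) := tendsto_const_nhds.div_atTop tendsto_id
      have h3 := (Real.continuousAt_rpow_const 0 p (Or.inr hp.le)).tendsto.comp h2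
      rwa [Real.zero_rpow hp.ne'] at h3
    filter_upwards [h1.eventually (gt_mem_nhds hδ)] with x hx using hx.le
  filter_upwards [eventually_ge_atTop x0, hsmall, hVinf.eventually_ge_atTop (C / δ)]
    with x hx hxs hVx n hn
  have hxpos : 0 < x := by linarith
  have hV := hpos x hx
  have hn0 : (0 : ℝ) ≤ n := n.cast_nonneg
  have hq0 : 0 ≤ r n / regVar a p x := div_nonneg (hrpos n).le hV.le
  have hu0' : 0 ≤ (n : ℝ) / x := by positivity
  have hup0 : 0 ≤ ((n : ℝ) / x) ^ p := Real.rpow_nonneg hu0' p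
  have habs : ∀ {s t : ℝ}, 0 ≤ s → 0 ≤ t → s ≤ δ → t ≤ δ → |s - t| ≤ δ := by
    intro s t hs ht hs' ht'
    rw [abs_le]; constructor <;> linarith
  -- For n < x0 Potter's bound is unavailable, but r n is bounded while the normalization tends to
  -- infinity.
  rcases lt_or_ge (n : ℝ) x0 with hnx | hnx
  · refine habs hq0 hup0 ?_ ?_
    · have h1 := hC' n (Nat.lt_ceil.2 hnx)
      rw [div_le_iff₀ hV]
      rw [div_le_iff₀ hδ] at hVx
      linarith
    · refine le_trans (Real.rpow_le_rpow hu0' ?_ hp.le) hxs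
      gcongr
  have hnpos : (0 : ℝ) < n := by linarith
  have hupos : 0 < (n : ℝ) / x := by positivity
  have hP := hx0 n x hnx hx
  rw [← Real.log_div hnpos.ne' hxpos.ne'] at hP
  set u := (n : ℝ) / x with hu
  set L := Real.log u with hL
  have hq : r n / regVar a p x =
      Real.exp (Real.log (r n) - Real.log (regVar a p x)) := by
    rw [Real.exp_sub, Real.exp_log (hrpos n), Real.exp_log hV]
  have hup : u ^ p = Real.exp (p * L) := by
    rw [Real.rpow_def_of_pos hupos, mul_comm]
  set d := Real.log (r n) - Real.log (regVar a p x) - p * L with hd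
  have hq2 : r n / regVar a p x = u ^ p * Real.exp d := by
    rw [hq, hup, ← Real.exp_add]; congr 1; rw [hd]; ring
  -- For small u both terms are at most u ^ (p / 2) e, hence at most δ; for the remaining u the
  -- logarithmic error d is at most θ.
  rcases lt_or_ge u u0 with hlt | hge
  · have hL0 : L < 0 := Real.log_neg hupos (by linarith)
    have hu0p : u ^ (p / 2) * Real.exp 1 ≤ δ := by
      refine le_trans ?_ hu2
      gcongr
    refine habs hq0 hup0 ?_ ?_
    · refine le_trans ?_ hu0p
      rw [hq, Real.rpow_def_of_pos hupos, ← Real.exp_add, Real.exp_le_exp]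
      rw [abs_of_neg hL0] at hP
      have := (abs_le.1 hP).2
      change Real.log (r n) - Real.log (regVar a p x) ≤ L * (p / 2) + 1
      nlinarith
    · refine le_trans ?_ hu0p
      rw [hup, Real.rpow_def_of_pos hupos, ← Real.exp_add, Real.exp_le_exp]
      change p * L ≤ L * (p / 2) + 1
      nlinarith
  · have huB : u ≤ B := by
      rw [hu, div_le_iff₀ hxpos]
      exact hn.trans (mul_le_mul_of_nonneg_right (le_max_left _ _) hxpos.le)
    have h1 : Real.log u0 ≤ L := Real.log_le_log hu0 hge
    have h2 : L ≤ Real.log B := Real.log_le_log hupos huB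
    have h3 : |L| + 1 ≤ Λ := by
      have : |L| ≤ |Real.log u0| + |Real.log B| := by
        rw [abs_le]
        constructor
        · linarith [neg_abs_le (Real.log u0), abs_nonneg (Real.log B)]
        · linarith [le_abs_self (Real.log B), abs_nonneg (Real.log u0)]
      linarith
    have h4 : |d| ≤ θ := hP.trans ((mul_le_mul_of_nonneg_left h3 hεpos.le).trans hε1)
    have h5 : |Real.exp d - 1| ≤ 2 * θ := by
      have := Real.abs_exp_sub_one_le (h4.trans hθ1)
      linarith
    rw [hq2, show u ^ p * Real.exp d - u ^ p = u ^ p * (Real.exp d - 1) by ring, abs_mul,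
      abs_of_nonneg hup0]
    calc u ^ p * |Real.exp d - 1| ≤ B ^ p * (2 * θ) := by gcongr
      _ ≤ δ := hθ2

/-- If one of the rates is negligible, a geometric test function has exponential decay rate
close to the total jump rate. -/
theorem exists_geometric_weight {b d : ℕ → ℝ} (hd : ∀ n, 0 ≤ d n)
    (hs : ∀ n, 0 < b n + d n)
    (h : Tendsto (fun n => d n / (b n + d n)) atTop (𝓝 0)) {η : ℝ} (hη : 0 < η) :
    ∃ ζ : ℝ, 0 < ζ ∧ ∃ C : ℝ, 0 ≤ C ∧
      ∀ n, (1 - η) * (b n + d n) ≤ b n * (1 - ζ) + d n * (1 - ζ⁻¹) + C := by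
  -- With ζ = η / 2, the loss b ζ is at most half of η (b + d), and d / ζ is at most the other half
  -- once d / (b + d) < η ^ 2 / 4. The constant C covers the finitely many other n.
  refine ⟨η / 2, by linarith, exists_bound_of_eventually_le ?_⟩
  filter_upwards [h.eventually (gt_mem_nhds (show 0 < η ^ 2 / 4 by positivity))] with n hn
  rw [div_lt_iff₀ (hs n)] at hn
  have h1 : d n * (η / 2)⁻¹ ≤ η / 2 * (b n + d n) := by
    rw [← div_eq_mul_inv, div_le_iff₀ (by linarith)]
    nlinarith
  nlinarith [hs n, hd n]

/-- Dividing by the regularly varying function of larger index reduces both limits to the vanishing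
of d against it. -/
theorem tendsto_sum_rates {a c : ℝ → ℝ} (ha : SlowlyVarying a) (hc : SlowlyVarying c) {p p' : ℝ}
    (hp : p' < p) {b d : ℕ → ℝ}
    (hb : Tendsto (fun n : ℕ => b n / regVar a p n) atTop (𝓝 1))
    (hd : Tendsto (fun n : ℕ => d n / regVar c p' n) atTop (𝓝 1)) :
    Tendsto (fun n : ℕ => (b n + d n) / regVar a p n) atTop (𝓝 1) ∧
      Tendsto (fun n => d n / (b n + d n)) atTop (𝓝 0) := by
  have h1 : Tendsto (fun n : ℕ => d n / regVar a p n) atTop (𝓝 0) := by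
    have h2 := hd.mul ((regVar_ratio_tendsto_zero hc ha hp).comp tendsto_natCast_atTop_atTop)
    rw [mul_zero] at h2
    refine h2.congr' ?_
    filter_upwards [tendsto_natCast_atTop_atTop.eventually (hc.regVar_pos p')] with n hn
    simp only [Function.comp]
    rw [div_mul_div_cancel₀ hn.ne']
  have h3 : Tendsto (fun n : ℕ => (b n + d n) / regVar a p n) atTop (𝓝 1) := by
    have := hb.add h1
    rw [add_zero] at this
    exact this.congr fun n => (add_div _ _ _).symm
  refine ⟨h3, ?_⟩
  have h4 := h1.div h3 one_ne_zero
  rw [zero_div] at h4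
  refine h4.congr' ?_
  filter_upwards [tendsto_natCast_atTop_atTop.eventually (ha.regVar_pos p)] with n hn
  simp only [Pi.div_apply]
  rw [div_div_div_cancel_right₀ hn.ne']

/-- The consequences of the regular variation of the rates: the total rate is regularly varying
with index `max l m`, and one of the rates is negligible. -/
theorem total_rate_regVar {lam mu : ℕ → ℝ} (hlam : ∀ x, 0 < lam x) (hmu : ∀ x, 0 ≤ mu x)
    {l m : ℝ} (hlm : l ≠ m) {y z : ℝ → ℝ} (hy : SlowlyVarying y) (hz : SlowlyVarying z)
    (hlamY : Tendsto (fun x : ℕ => lam x / regVar y l (x : ℝ)) atTop (𝓝 1))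
    (hmuZ : Tendsto (fun x : ℕ => mu x / regVar z m (x : ℝ)) atTop (𝓝 1))
    {V : ℝ → ℝ} (hV : ∀ x, V x = max (regVar y l x) (regVar z m x)) :
    ∃ a, SlowlyVarying a ∧ V =ᶠ[atTop] regVar a (max l m) ∧
      Tendsto (fun n : ℕ => (lam n + mu n) / regVar a (max l m) n) atTop (𝓝 1) ∧
      ∀ η : ℝ, 0 < η → ∃ ζ : ℝ, 0 < ζ ∧ ∃ C : ℝ, 0 ≤ C ∧
        ∀ n, (1 - η) * (lam n + mu n) ≤ lam n * (1 - ζ) + mu n * (1 - ζ⁻¹) + C := by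
  have hs : ∀ n, 0 < lam n + mu n := fun n => add_pos_of_pos_of_nonneg (hlam n) (hmu n)
  rcases lt_or_gt_of_ne hlm with h | h
  · refine ⟨z, hz, ?_, ?_, ?_⟩
    · filter_upwards [hz.regVar_pos m, (regVar_ratio_tendsto_zero hy hz h).eventually
        (gt_mem_nhds one_pos)] with x h1 h2
      rw [div_lt_one h1] at h2
      rw [hV, max_eq_right h2.le, max_eq_right h.le]
    · rw [max_eq_right h.le]
      have := (tendsto_sum_rates hz hy h hmuZ hlamY).1
      exact this.congr fun n => by rw [add_comm]
    · intro η hη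
      have h2 := (tendsto_sum_rates hz hy h hmuZ hlamY).2
      obtain ⟨ζ, hζ, C, hC, hC'⟩ := exists_geometric_weight (fun n => (hlam n).le)
        (fun n => by linarith [hs n]) h2 hη
      -- Deaths dominate here, so births and deaths exchange roles and the geometric weight is
      -- inverted.
      refine ⟨ζ⁻¹, inv_pos.2 hζ, C, hC, fun n => ?_⟩
      rw [inv_inv]
      linarith [hC' n]
  · refine ⟨y, hy, ?_, ?_, ?_⟩
    · filter_upwards [hy.regVar_pos l, (regVar_ratio_tendsto_zero hz hy h).eventually
        (gt_mem_nhds one_pos)] with x h1 h2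
      rw [div_lt_one h1] at h2
      rw [hV, max_eq_left h2.le, max_eq_left h.le]
    · rw [max_eq_left h.le]
      exact (tendsto_sum_rates hy hz h hlamY hmuZ).1
    · intro η hη
      exact exists_geometric_weight hmu hs
        (tendsto_sum_rates hy hz h hlamY hmuZ).2 hη


/-! ### Exponential laws -/

theorem expMeasure_Ioi {r : ℝ} (hr : 0 < r) (s : ℝ) :
    expMeasure r (Ioi s) = ENNReal.ofReal (Real.exp (-(r * max s 0))) := by
  have := isProbabilityMeasure_expMeasure hr
  rw [← compl_Iic, prob_compl_eq_one_sub measurableSet_Iic, ← ofReal_cdf, cdf_expMeasure_eq hr,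
    ← ENNReal.ofReal_one]
  split_ifs with h
  · rw [← ENNReal.ofReal_sub _ (by
      rw [sub_nonneg, Real.exp_le_one_iff]; nlinarith), max_eq_left h]
    congr 1; ring
  · rw [max_eq_right (by linarith)]
    simp

theorem expMeasure_Ioc {r : ℝ} (hr : 0 < r) {s t : ℝ} (hs : 0 ≤ s) (hst : s ≤ t) :
    expMeasure r (Ioc s t) =
      ENNReal.ofReal (Real.exp (-(r * s)) - Real.exp (-(r * t))) := by
  have := isProbabilityMeasure_expMeasure hr
  rw [← Ioi_sdiff_Ioi, measure_sdiff (Ioi_subset_Ioi hst) measurableSet_Ioi.nullMeasurableSet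
    (measure_ne_top _ _), expMeasure_Ioi hr, expMeasure_Ioi hr, max_eq_left hs,
    max_eq_left (hs.trans hst), ENNReal.ofReal_sub _ (Real.exp_pos _).le]

theorem lintegral_exp_expMeasure {r a : ℝ} (hr : 0 < r) (ha : a < r) :
    ∫⁻ s, ENNReal.ofReal (Real.exp (a * s)) ∂(expMeasure r) = ENNReal.ofReal (r / (r - a)) := by
  have hra : 0 < r - a := sub_pos.2 ha
  change ∫⁻ s, ENNReal.ofReal (Real.exp (a * s)) ∂(volume.withDensity (exponentialPDF r)) = _
  have hpdf : Measurable (exponentialPDF r) := (measurable_exponentialPDFReal r).ennreal_ofReal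
  rw [lintegral_withDensity_eq_lintegral_mul _ hpdf (by fun_prop)]
  have : ∀ s, (exponentialPDF r * fun s => ENNReal.ofReal (Real.exp (a * s))) s =
      ENNReal.ofReal (r / (r - a)) * exponentialPDF (r - a) s := by
    intro s
    simp only [Pi.mul_apply, exponentialPDF_eq]
    split_ifs with h
    · rw [← ENNReal.ofReal_mul (by positivity), ← ENNReal.ofReal_mul (by positivity)]
      congr 1
      rw [mul_assoc, ← Real.exp_add, ← mul_assoc, div_mul_cancel₀ _ hra.ne']
      congr 2; ring
    · simp
  simp_rw [this]
  have hpdf' : Measurable (exponentialPDF (r - a)) :=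
    (measurable_exponentialPDFReal _).ennreal_ofReal
  rw [lintegral_const_mul _ hpdf', lintegral_exponentialPDF_eq_one hra, mul_one]

/-! ### Sums over paths of the jump chain -/

/-- The sum over paths `0 = x 0, …, x n` of the products of the weights `k (x i) (x (i + 1))`,
with terminal weight `h (x n)`. -/
noncomputable def pathSum (k : ℕ → ℕ → ENNReal) (n : ℕ) (h : ℕ → ENNReal) : ENNReal :=
  ∑' x : Fin (n + 1) → ℕ,
    ((if x 0 = 0 then 1 else 0) * ∏ i : Fin n, k (x i.castSucc) (x i.succ)) * h (x (Fin.last n))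

theorem pathSum_zero (k : ℕ → ℕ → ENNReal) (h : ℕ → ENNReal) : pathSum k 0 h = h 0 := by
  rw [pathSum, ← (Equiv.funUnique (Fin 1) ℕ).symm.tsum_eq]
  rw [tsum_eq_single 0]
  · simp
  · intro b hb
    simp [hb]

/-- Summing over the last state first turns the last step into a new terminal weight; this is the
recursion behind all inductions on path length. -/
theorem pathSum_succ (k : ℕ → ℕ → ENNReal) (n : ℕ) (h : ℕ → ENNReal) :
    pathSum k (n + 1) h = pathSum k n (fun x => ∑' x', k x x' * h x') := by
  rw [pathSum, pathSum, ← (Fin.snocEquiv fun _ => ℕ).tsum_eq, ← (Equiv.prodComm _ _).tsum_eq]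
  rw [ENNReal.tsum_prod']
  refine tsum_congr fun x => ?_
  rw [← ENNReal.tsum_mul_left]
  refine tsum_congr fun x' => ?_
  have h0 : (Fin.snoc x x' : Fin (n + 2) → ℕ) 0 = x 0 := by simp
  have h1 : ∀ i : Fin n, (Fin.snoc x x' : Fin (n + 2) → ℕ) i.castSucc.succ = x i.succ := by
    intro i
    rw [Fin.succ_castSucc]
    exact Fin.snoc_castSucc (α := fun _ => ℕ) x' x i.succ
  simp only [Fin.snocEquiv, Equiv.coe_fn_mk, Equiv.prodComm_apply, Prod.swap, Fin.snoc_last, h0,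
    Fin.prod_univ_castSucc (n := n), h1, Fin.snoc_castSucc, Fin.succ_last]
  ring

theorem pathSum_mono (k : ℕ → ℕ → ENNReal) (n : ℕ) {h h' : ℕ → ENNReal} (hh : ∀ x, h x ≤ h' x) :
    pathSum k n h ≤ pathSum k n h' :=
  ENNReal.tsum_le_tsum fun _ => mul_le_mul_right (hh _) _

theorem pathSum_const_mul (k : ℕ → ℕ → ENNReal) (n : ℕ) (c : ENNReal) (h : ℕ → ENNReal) :
    pathSum k n (fun x => c * h x) = c * pathSum k n h := by
  rw [pathSum, pathSum, ← ENNReal.tsum_mul_left]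
  exact tsum_congr fun x => by ring

/-- A weight that the kernel contracts by ρ loses a factor ρ at every step; for ρ < 1 this makes the
series over path lengths geometric. -/
theorem pathSum_le {k : ℕ → ℕ → ENNReal} {h : ℕ → ENNReal} {ρ : ENNReal}
    (hk : ∀ x, ∑' x', k x x' * h x' ≤ ρ * h x) (n : ℕ) : pathSum k n h ≤ ρ ^ n * h 0 := by
  induction n with
  | zero => simp [pathSum_zero]
  | succ n ih =>
    rw [pathSum_succ]
    refine (pathSum_mono k n hk).trans ?_
    rw [pathSum_const_mul, pow_succ']
    rw [mul_assoc]
    exact mul_le_mul_right ih _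

theorem pathSum_one {k : ℕ → ℕ → ENNReal} (hk : ∀ x, ∑' x', k x x' = 1) (n : ℕ) :
    pathSum k n (fun _ => 1) = 1 := by
  induction n with
  | zero => simp [pathSum_zero]
  | succ n ih =>
    rw [pathSum_succ]
    simp [hk, ih]

/-! ### Joint law of the jump chain and the holding times -/

/-- The embedded jump chain `X` and the holding times `S` of a birth-and-death process. -/
structure JumpHoldLaw {Ω : Type*} [MeasurableSpace Ω] (P : Measure Ω) (lam mu : ℕ → ℝ)
    (X : ℕ → Ω → ℕ) (S : ℕ → Ω → ℝ) : Prop where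
  measurable_chain : ∀ n, Measurable (X n)
  measurable_hold : ∀ n, Measurable (S n)
  law : ∀ (n : ℕ) (x : ℕ → ℕ) (s : ℕ → ℝ), (∀ i, 0 ≤ s i) →
      P {ω | ∀ i ≤ n, X i ω = x i ∧ s i < S i ω} =
        ENNReal.ofReal ((if x 0 = 0 then 1 else 0) *
          (∏ i ∈ Finset.range n, jumpProb lam mu (x i) (x (i + 1))) *
          ∏ i ∈ Finset.range (n + 1), Real.exp (-((lam (x i) + mu (x i)) * s i)))

theorem jumpProb_nonneg {lam mu : ℕ → ℝ} (hlam : ∀ x, 0 < lam x) (hmu : ∀ x, 0 ≤ mu x)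
    (x x' : ℕ) : 0 ≤ jumpProb lam mu x x' := by
  have := hlam x
  have := hmu x
  unfold jumpProb
  split_ifs <;> positivity

/-- The action of the jump matrix on a function. -/
theorem tsum_jumpProb_mul {lam mu : ℕ → ℝ} (hlam : ∀ x, 0 < lam x) (hmu : ∀ x, 0 ≤ mu x)
    (hmu0 : mu 0 = 0) {g : ℕ → ℝ} (hg : ∀ x, 0 ≤ g x) (x : ℕ) :
    ∑' x', ENNReal.ofReal (jumpProb lam mu x x') * ENNReal.ofReal (g x') =
      ENNReal.ofReal ((lam x * g (x + 1) + mu x * g (x - 1)) / (lam x + mu x)) := by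
  have hl := hlam x
  have hm := hmu x
  cases x with
  | zero =>
    rw [tsum_eq_single 1]
    · rw [← ENNReal.ofReal_mul (jumpProb_nonneg hlam hmu _ _)]
      simp [jumpProb, hmu0, hl.ne']
    · intro b hb
      simp [jumpProb, hb]
  | succ x =>
    rw [tsum_eq_sum (s := {x + 2, x})]
    · rw [Finset.sum_pair (by omega), ← ENNReal.ofReal_mul (jumpProb_nonneg hlam hmu _ _),
        ← ENNReal.ofReal_mul (jumpProb_nonneg hlam hmu _ _), ← ENNReal.ofReal_add]
      · simp only [jumpProb, Nat.add_sub_cancel, if_true, show x ≠ x + 1 + 1 by omega, if_false]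
        congr 1
        ring
      · exact mul_nonneg (jumpProb_nonneg hlam hmu _ _) (hg _)
      · exact mul_nonneg (jumpProb_nonneg hlam hmu _ _) (hg _)
    · intro b hb
      simp only [Finset.mem_insert, Finset.mem_singleton, not_or] at hb
      simp only [jumpProb]
      rw [if_neg (by omega), if_neg (by omega)]
      simp

/-- The probability of a path of the embedded chain. -/
noncomputable def pathWeight (lam mu : ℕ → ℝ) {n : ℕ} (x : Fin (n + 1) → ℕ) : ENNReal :=
  (if x 0 = 0 then 1 else 0) * ∏ i : Fin n, ENNReal.ofReal (jumpProb lam mu (x i.castSucc) (x i.succ))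

namespace JumpHoldLaw

variable {Ω : Type*} [MeasurableSpace Ω] {P : Measure Ω} {lam mu : ℕ → ℝ}
  {X : ℕ → Ω → ℕ} {S : ℕ → Ω → ℝ}

theorem law_fin (H : JumpHoldLaw P lam mu X S) (hlam : ∀ x, 0 < lam x) (hmu : ∀ x, 0 ≤ mu x)
    {n : ℕ} (x : Fin (n + 1) → ℕ) (s : Fin (n + 1) → ℝ) (hs : ∀ i, 0 ≤ s i) :
    P {ω | ∀ i : Fin (n + 1), X i ω = x i ∧ s i < S i ω} =
      pathWeight lam mu x * ∏ i, expMeasure (lam (x i) + mu (x i)) (Ioi (s i)) := by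
  have hq : ∀ x, 0 < lam x + mu x := fun x => add_pos_of_pos_of_nonneg (hlam x) (hmu x)
  -- `law` takes infinite sequences, with all thresholds nonnegative, so the finite data are
  -- extended by 0.
  set x' : ℕ → ℕ := fun i => if h : i < n + 1 then x ⟨i, h⟩ else 0 with hx'
  set s' : ℕ → ℝ := fun i => if h : i < n + 1 then s ⟨i, h⟩ else 0 with hs'
  have hx1 : ∀ i : Fin (n + 1), x' i = x i := fun i => by simp only [hx']; rw [dif_pos i.2]
  have hs1 : ∀ i : Fin (n + 1), s' i = s i := fun i => by simp only [hs']; rw [dif_pos i.2]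
  have h := H.law n x' s' (fun i => by
    simp only [hs']; split_ifs with h; exacts [hs _, le_rfl])
  have hset : {ω | ∀ i ≤ n, X i ω = x' i ∧ s' i < S i ω} =
      {ω | ∀ i : Fin (n + 1), X i ω = x i ∧ s i < S i ω} := by
    ext ω
    constructor
    · intro hω i
      have := hω i (Nat.lt_succ_iff.1 i.2)
      rwa [hx1, hs1] at this
    · intro hω i hi
      have := hω ⟨i, Nat.lt_succ_iff.2 hi⟩
      rw [← hx1, ← hs1] at this
      exact this
  rw [hset] at h
  rw [h, Finset.prod_range, Finset.prod_range]
  have e0 : x' 0 = x 0 := hx1 0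
  have e1 : ∀ i : Fin n, x' i = x i.castSucc := fun i => hx1 i.castSucc
  have e2 : ∀ i : Fin n, x' (i + 1) = x i.succ := fun i => hx1 i.succ
  simp only [hx1, hs1, e0, e1, e2]
  have hp : 0 ≤ ∏ i : Fin n, jumpProb lam mu (x i.castSucc) (x i.succ) :=
    Finset.prod_nonneg fun i _ => jumpProb_nonneg hlam hmu _ _
  have hi : (0 : ℝ) ≤ if x 0 = 0 then 1 else 0 := by split_ifs <;> norm_num
  rw [ENNReal.ofReal_mul (mul_nonneg hi hp), ENNReal.ofReal_mul hi,
    ENNReal.ofReal_prod_of_nonneg (fun i _ => jumpProb_nonneg hlam hmu _ _),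
    ENNReal.ofReal_prod_of_nonneg (fun i _ => (Real.exp_pos _).le), pathWeight]
  congr 1
  · congr 1
    split_ifs <;> simp
  · refine Finset.prod_congr rfl fun i _ => ?_
    rw [expMeasure_Ioi (hq _), max_eq_left (hs i)]

theorem measurableSet_path_hold (H : JumpHoldLaw P lam mu X S) {n : ℕ} (x : Fin (n + 1) → ℕ)
    (s : Fin (n + 1) → ℝ) :
    MeasurableSet {ω | ∀ i : Fin (n + 1), X i ω = x i ∧ s i < S i ω} := by
  have : {ω | ∀ i : Fin (n + 1), X i ω = x i ∧ s i < S i ω} =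
      ⋂ i : Fin (n + 1), X i ⁻¹' {x i} ∩ S i ⁻¹' (Ioi (s i)) := by
    ext ω; simp
  rw [this]
  exact MeasurableSet.iInter fun i => (H.measurable_chain _ (measurableSet_singleton _)).inter
    (H.measurable_hold _ measurableSet_Ioi)

/-- Holding times are almost surely positive. -/
theorem hold_pos (H : JumpHoldLaw P lam mu X S) [IsProbabilityMeasure P]
    (hlam : ∀ x, 0 < lam x) (hmu : ∀ x, 0 ≤ mu x) (hmu0 : mu 0 = 0) :
    ∀ᵐ ω ∂P, ∀ i, 0 < S i ω := by
  have hq : ∀ x, 0 < lam x + mu x := fun x => add_pos_of_pos_of_nonneg (hlam x) (hmu x)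
  rw [ae_all_iff]
  intro n
  -- The law only describes events on which the holding times exceed nonnegative thresholds.
  -- Positivity follows because, at threshold 0, these events already have total mass 1 over all
  -- paths.
  have h1 : pathSum (fun x x' => ENNReal.ofReal (jumpProb lam mu x x')) n (fun _ => 1) = 1 := by
    refine pathSum_one (fun x => ?_) n
    have := tsum_jumpProb_mul hlam hmu hmu0 (g := fun _ => 1) (fun _ => zero_le_one) x
    simpa [(hq x).ne'] using this
  have h2 : P (⋃ x : Fin (n + 1) → ℕ, {ω | ∀ i : Fin (n + 1), X i ω = x i ∧ 0 < S i ω}) = 1 := by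
    rw [measure_iUnion, ← h1, pathSum]
    · refine tsum_congr fun x => ?_
      have := H.law_fin hlam hmu x (fun _ => 0) fun _ => le_rfl
      rw [this, pathWeight]
      congr 1
      refine Finset.prod_eq_one fun i _ => ?_
      rw [expMeasure_Ioi (hq _)]
      simp
    · intro x x' hxx'
      rw [Function.onFun, Set.disjoint_left]
      intro ω h h'
      exact hxx' (funext fun i => (h i).1.symm.trans (h' i).1)
    · exact fun x => H.measurableSet_path_hold x fun _ => 0
  have h3 := (prob_compl_eq_zero_iff
    (MeasurableSet.iUnion fun x => H.measurableSet_path_hold x fun _ => 0)).2 h2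
  have h4 := compl_mem_ae_iff.2 h3
  rw [compl_compl] at h4
  filter_upwards [h4] with ω hω
  obtain ⟨x, hx⟩ := mem_iUnion.1 hω
  exact (hx (Fin.last n)).2

theorem pathWeight_ne_top {n : ℕ} (x : Fin (n + 1) → ℕ) : pathWeight lam mu x ≠ ⊤ := by
  refine ENNReal.mul_ne_top (by split_ifs <;> simp) ?_
  exact ENNReal.prod_ne_top fun i _ => ENNReal.ofReal_ne_top

/-- On a path of the chain, the holding times are independent exponential variables. -/
theorem map_hold_restrict (H : JumpHoldLaw P lam mu X S) [IsProbabilityMeasure P]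
    (hlam : ∀ x, 0 < lam x) (hmu : ∀ x, 0 ≤ mu x) (hmu0 : mu 0 = 0)
    {n : ℕ} (x : Fin (n + 1) → ℕ) :
    (P.restrict {ω | ∀ i : Fin (n + 1), X i ω = x i}).map (fun ω (i : Fin (n + 1)) => S i ω) =
      pathWeight lam mu x • Measure.pi fun i => expMeasure (lam (x i) + mu (x i)) := by
  have hq : ∀ x, 0 < lam x + mu x := fun x => add_pos_of_pos_of_nonneg (hlam x) (hmu x)
  have hprob : ∀ i, IsProbabilityMeasure (expMeasure (lam (x i) + mu (x i))) := fun i =>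
    isProbabilityMeasure_expMeasure (hq _)
  have hmeas : Measurable fun ω (i : Fin (n + 1)) => S i ω :=
    measurable_pi_lambda _ fun i => H.measurable_hold _
  have key : ∀ s : Fin (n + 1) → ℝ,
      (P.restrict {ω | ∀ i : Fin (n + 1), X i ω = x i}).map (fun ω (i : Fin (n + 1)) => S i ω)
        (univ.pi fun i => Ioi (s i)) =
      pathWeight lam mu x * ∏ i, expMeasure (lam (x i) + mu (x i)) (Ioi (s i)) := by
    intro s
    -- Negative thresholds are replaced by 0, which changes nothing almost surely for positive
    -- holding times.
    have h1 := H.law_fin hlam hmu x (fun i => max (s i) 0) fun i => le_max_right _ _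
    have h2 : ∀ i, expMeasure (lam (x i) + mu (x i)) (Ioi (max (s i) 0)) =
        expMeasure (lam (x i) + mu (x i)) (Ioi (s i)) := fun i => by
      rw [expMeasure_Ioi (hq _), expMeasure_Ioi (hq _), max_eq_left (le_max_right _ _)]
    simp only [h2] at h1
    rw [← h1, Measure.map_apply hmeas (MeasurableSet.univ_pi fun i => measurableSet_Ioi),
      Measure.restrict_apply (hmeas (MeasurableSet.univ_pi fun i => measurableSet_Ioi))]
    refine measure_congr ?_
    filter_upwards [H.hold_pos hlam hmu hmu0] with ω hω
    refine propext ?_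
    change ((fun i : Fin (n + 1) => S i ω) ∈ univ.pi (fun i => Ioi (s i)) ∧
      (∀ i : Fin (n + 1), X i ω = x i)) ↔ ∀ i : Fin (n + 1), X i ω = x i ∧ max (s i) 0 < S i ω
    simp only [mem_univ_pi, mem_Ioi, max_lt_iff, hω, and_true]
    rw [← forall_and]
    exact forall_congr' fun i => and_comm
  -- Identification on the π-system of boxes of open rays needs a normalized measure, hence division
  -- by the path weight; paths of weight zero are treated separately, both sides then vanishing.
  rcases eq_or_ne (pathWeight lam mu x) 0 with h0 | h0
  · rw [h0, zero_smul, Measure.map_eq_zero_iff hmeas.aemeasurable, Measure.restrict_eq_zero]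
    have h1 := H.law_fin hlam hmu x (fun _ => 0) fun _ => le_rfl
    rw [h0, zero_mul] at h1
    refine measure_mono_null_ae ?_ h1
    filter_upwards [H.hold_pos hlam hmu hmu0] with ω hω hω2
    exact fun i => ⟨hω2 i, hω _⟩
  · have h := Measure.pi_eq_generateFrom (μ := fun i => expMeasure (lam (x i) + mu (x i)))
      (C := fun _ => Set.range Ioi)
      (fun _ => by rw [BorelSpace.measurable_eq (α := ℝ), borel_eq_generateFrom_Ioi])
      (fun _ => isPiSystem_Ioi)
      (fun i => ⟨fun k => Ioi (-(k : ℝ)), fun k => ⟨_, rfl⟩, fun k => measure_lt_top _ _, by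
        refine eq_univ_of_forall fun y => mem_iUnion.2 ?_
        obtain ⟨k, hk⟩ := exists_nat_gt (-y)
        exact ⟨k, by simp only [mem_Ioi]; linarith⟩⟩)
      (μν := (pathWeight lam mu x)⁻¹ •
        (P.restrict {ω | ∀ i : Fin (n + 1), X i ω = x i}).map (fun ω (i : Fin (n + 1)) => S i ω))
      (fun s hs => by
        choose t ht using hs
        obtain rfl : s = fun i => Ioi (t i) := funext fun i => (ht i).symm
        rw [Measure.smul_apply, key, smul_eq_mul, ← mul_assoc,
          ENNReal.inv_mul_cancel h0 (pathWeight_ne_top x), one_mul])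
    rw [h, smul_smul, ENNReal.mul_inv_cancel h0 (pathWeight_ne_top x), one_smul]

theorem lintegral_prod_hold (H : JumpHoldLaw P lam mu X S) [IsProbabilityMeasure P]
    (hlam : ∀ x, 0 < lam x) (hmu : ∀ x, 0 ≤ mu x) (hmu0 : mu 0 = 0)
    {n : ℕ} (x : Fin (n + 1) → ℕ) {g : Fin (n + 1) → ℝ → ENNReal} (hg : ∀ i, Measurable (g i)) :
    ∫⁻ ω in {ω | ∀ i : Fin (n + 1), X i ω = x i}, ∏ i : Fin (n + 1), g i (S i ω) ∂P =
      pathWeight lam mu x * ∏ i, ∫⁻ s, g i s ∂(expMeasure (lam (x i) + mu (x i))) := by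
  have hq : ∀ x, 0 < lam x + mu x := fun x => add_pos_of_pos_of_nonneg (hlam x) (hmu x)
  have hprob : ∀ i, IsProbabilityMeasure (expMeasure (lam (x i) + mu (x i))) := fun i =>
    isProbabilityMeasure_expMeasure (hq _)
  have hmeas : Measurable fun ω (i : Fin (n + 1)) => S i ω :=
    measurable_pi_lambda _ fun i => H.measurable_hold _
  have hG : Measurable fun s : Fin (n + 1) → ℝ => ∏ i, g i (s i) :=
    Finset.measurable_prod _ fun i _ => (hg i).comp (measurable_pi_apply i)
  rw [← lintegral_map (f := fun s : Fin (n + 1) → ℝ => ∏ i, g i (s i)) hG hmeas,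
    H.map_hold_restrict hlam hmu hmu0, lintegral_smul_measure, smul_eq_mul,
    lintegral_prod_eq_prod_lintegral_of_indepFun _ (fun i (s : Fin (n + 1) → ℝ) => g i (s i))
      (iIndepFun_pi fun i => (hg i).aemeasurable) fun i => (hg i).comp (measurable_pi_apply i)]
  congr 1
  refine Finset.prod_congr rfl fun i _ => ?_
  exact (measurePreserving_eval (fun i => expMeasure (lam (x i) + mu (x i))) i).lintegral_comp (hg i)

end JumpHoldLaw


/-! ### Exponential bound for the cost integral. -/

/-- Minus the generator of the birth-and-death process applied to `x ↦ ζ ^ x`, divided by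
`ζ ^ x`. -/
noncomputable def tilt (lam mu : ℕ → ℝ) (ζ : ℝ) (x : ℕ) : ℝ := lam x * (1 - ζ) + mu x * (1 - ζ⁻¹)

/-- The integral `∫₀ᵀ G (ξ s) ds`, when `ξ` has performed exactly `n` jumps by time `T`. -/
noncomputable def pathIntegral (G : ℕ → ℝ) (x : ℕ → ℕ) (s : ℕ → ℝ) (n : ℕ) (T : ℝ) : ℝ :=
  (∑ i ∈ Finset.range n, G (x i) * s i) + G (x n) * (T - jumpTime s n)

/-- The trajectories with exactly `n` jumps by time `T` which stay below `K` and along which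
the integral of `G` is at least `L`. -/
def costEvent {Ω : Type*} (X : ℕ → Ω → ℕ) (S : ℕ → Ω → ℝ) (G : ℕ → ℝ) (K : ℕ) (L T : ℝ)
    (n : ℕ) : Set Ω :=
  {ω | (∀ i ≤ n, X i ω ≤ K) ∧ jumpTime (fun i => S i ω) n ≤ T ∧
    T < jumpTime (fun i => S i ω) (n + 1) ∧
    L ≤ pathIntegral G (fun i => X i ω) (fun i => S i ω) n T}

theorem one_le_max_inv {ζ : ℝ} (hζ : 0 < ζ) : 1 ≤ max ζ ζ⁻¹ := by
  rcases le_total 1 ζ with h | h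
  · exact h.trans (le_max_left _ _)
  · exact ((one_le_inv₀ hζ).2 h).trans (le_max_right _ _)

/-- This bounds the terminal weight ζ ^ k from below, whether ζ is below or above 1, at a price
exponential in K only. -/
theorem one_le_pow_mul_pow {ζ : ℝ} (hζ : 0 < ζ) {K k : ℕ} (hk : k ≤ K) :
    1 ≤ max ζ ζ⁻¹ ^ K * ζ ^ k := by
  have hζ' : 0 < ζ⁻¹ := inv_pos.2 hζ
  have h1 := one_le_max_inv hζ
  calc (1 : ℝ) = ζ⁻¹ ^ k * ζ ^ k := by rw [← mul_pow, inv_mul_cancel₀ hζ.ne', one_pow]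
    _ ≤ max ζ ζ⁻¹ ^ k * ζ ^ k := by gcongr; exact le_max_right _ _
    _ ≤ max ζ ζ⁻¹ ^ K * ζ ^ k := by gcongr

namespace JumpHoldLaw

variable {Ω : Type*} [MeasurableSpace Ω] {P : Measure Ω} {lam mu : ℕ → ℝ}
  {X : ℕ → Ω → ℕ} {S : ℕ → Ω → ℝ}

/-- Chernoff's bound on one path. Lowering each exponent by 1 before the last holding time is paid
for by the factor exp T, since these times add up to at most T. In return every denominator gains 1,
which later makes the sum over paths contract. -/
theorem measure_costEvent_path_le (H : JumpHoldLaw P lam mu X S) [IsProbabilityMeasure P]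
    (hlam : ∀ x, 0 < lam x) (hmu : ∀ x, 0 ≤ mu x) (hmu0 : mu 0 = 0) {ζ : ℝ} (hζ : 0 < ζ)
    (K : ℕ) (L T : ℝ) {n : ℕ} (x : Fin (n + 1) → ℕ) (hx : ∀ i, x i ≤ K) :
    P (costEvent X S (tilt lam mu ζ) K L T n ∩ {ω | ∀ i : Fin (n + 1), X i ω = x i}) ≤
      ENNReal.ofReal (Real.exp (T - L) * max ζ ζ⁻¹ ^ K * max ζ ζ⁻¹) *
        (pathWeight lam mu x * (∏ i : Fin n, ENNReal.ofReal
          ((lam (x i.castSucc) + mu (x i.castSucc)) /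
            (lam (x i.castSucc) * ζ + mu (x i.castSucc) * ζ⁻¹ + 1))) *
          ENNReal.ofReal (ζ ^ x (Fin.last n))) := by
  have hζ' : 0 < ζ⁻¹ := inv_pos.2 hζ
  have hq : ∀ x, 0 < lam x + mu x := fun x => add_pos_of_pos_of_nonneg (hlam x) (hmu x)
  set Ξ := max ζ ζ⁻¹ with hΞ
  have hΞ0 : 0 < Ξ := lt_max_of_lt_left hζ
  have hΞ1 : 1 ≤ Ξ := one_le_max_inv hζ
  set G := tilt lam mu ζ with hG
  have hGq : ∀ x, lam x + mu x - G x = lam x * ζ + mu x * ζ⁻¹ := fun x => by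
    rw [hG, tilt]; ring
  have hrpos : ∀ x, 0 < lam x * ζ + mu x * ζ⁻¹ := fun x =>
    add_pos_of_pos_of_nonneg (mul_pos (hlam x) hζ) (mul_nonneg (hmu x) hζ'.le)
  -- The last holding time is cut at T, so only a lower bound for it is known; the positive part
  -- lets it replace T - `jumpTime` n.
  set Gp : ℝ := max (G (x (Fin.last n))) 0 with hGp
  set α : Fin (n + 1) → ℝ := Fin.snoc (fun i : Fin n => G (x i.castSucc) - 1) Gp with hα
  have hα1 : ∀ i : Fin n, α i.castSucc = G (x i.castSucc) - 1 := fun i =>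
    Fin.snoc_castSucc (α := fun _ => ℝ) _ _ i
  have hα2 : α (Fin.last n) = Gp := Fin.snoc_last (α := fun _ => ℝ) _ _
  set C : ℝ := Real.exp (T - L) * Ξ ^ K * ζ ^ x (Fin.last n) with hC
  have hC0 : 0 ≤ C := by positivity
  have hmeas : ∀ i, Measurable fun s => ENNReal.ofReal (Real.exp (α i * s)) := fun i => by fun_prop
  have hPmeas : Measurable fun ω => ∏ i : Fin (n + 1), ENNReal.ofReal (Real.exp (α i * S i ω)) :=
    Finset.measurable_prod _ fun i _ => (hmeas i).comp (H.measurable_hold i)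
  have hFmeas := hPmeas.const_mul (ENNReal.ofReal C)
  -- Chernoff's bound on the given path
  have hsub : P (costEvent X S G K L T n ∩ {ω | ∀ i : Fin (n + 1), X i ω = x i}) ≤
      (P.restrict {ω | ∀ i : Fin (n + 1), X i ω = x i}) {ω | 1 ≤ ENNReal.ofReal C *
        ∏ i : Fin (n + 1), ENNReal.ofReal (Real.exp (α i * S i ω))} := by
    rw [Measure.restrict_apply (measurableSet_le measurable_const hFmeas)]
    refine measure_mono_ae ?_
    filter_upwards [H.hold_pos hlam hmu hmu0] with ω hω hE
    obtain ⟨⟨-, hT1, hT2, hL⟩, hxω⟩ := hE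
    refine ⟨?_, hxω⟩
    change 1 ≤ ENNReal.ofReal C * ∏ i : Fin (n + 1), ENNReal.ofReal (Real.exp (α i * S i ω))
    rw [← ENNReal.ofReal_prod_of_nonneg (fun i _ => (Real.exp_pos _).le), ← Real.exp_sum,
      ← ENNReal.ofReal_mul hC0, ENNReal.one_le_ofReal, hC]
    have h1 : 0 ≤ T - L + ∑ i, α i * S i ω := by
      rw [Fin.sum_univ_castSucc, hα2]
      simp only [hα1, Fin.val_castSucc, Fin.val_last]
      rw [pathIntegral, Finset.sum_range] at hL
      have hXlast : X n ω = x (Fin.last n) := hxω (Fin.last n)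
      have hXi : ∀ i : Fin n, X i ω = x i.castSucc := fun i => hxω i.castSucc
      simp only [hXlast, hXi] at hL
      have h2 : jumpTime (fun i => S i ω) n = ∑ i : Fin n, S i ω := by
        rw [jumpTime, Finset.sum_range]
      have h3 : jumpTime (fun i => S i ω) (n + 1) = jumpTime (fun i => S i ω) n + S n ω := by
        rw [jumpTime, jumpTime, Finset.sum_range_succ]
      have h4 : G (x (Fin.last n)) * (T - jumpTime (fun i => S i ω) n) ≤ Gp * S n ω := by
        calc _ ≤ Gp * (T - jumpTime (fun i => S i ω) n) :=
              mul_le_mul_of_nonneg_right (le_max_left _ _) (by linarith)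
          _ ≤ Gp * S n ω := mul_le_mul_of_nonneg_left (by linarith) (le_max_right _ _)
      have h5 : ∑ i : Fin n, (G (x i.castSucc) - 1) * S i ω =
          ∑ i : Fin n, G (x i.castSucc) * S i ω - jumpTime (fun i => S i ω) n := by
        rw [h2, ← Finset.sum_sub_distrib]
        exact Finset.sum_congr rfl fun i _ => by ring
      rw [h5]
      linarith
    calc (1 : ℝ) ≤ (Ξ ^ K * ζ ^ x (Fin.last n)) * Real.exp (T - L + ∑ i, α i * S i ω) :=
          one_le_mul_of_one_le_of_one_le (one_le_pow_mul_pow hζ (hx _)) (Real.one_le_exp h1)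
      _ = _ := by rw [Real.exp_add]; ring
  refine hsub.trans ?_
  have hmarkov := mul_meas_ge_le_lintegral (μ := P.restrict {ω | ∀ i : Fin (n + 1), X i ω = x i})
    hFmeas 1
  rw [one_mul] at hmarkov
  refine hmarkov.trans ?_
  rw [lintegral_const_mul _ hPmeas, H.lintegral_prod_hold hlam hmu hmu0 x hmeas,
    Fin.prod_univ_castSucc, hα2]
  have hA : ∀ i : Fin n, ∫⁻ s, ENNReal.ofReal (Real.exp (α i.castSucc * s))
      ∂(expMeasure (lam (x i.castSucc) + mu (x i.castSucc))) =
      ENNReal.ofReal ((lam (x i.castSucc) + mu (x i.castSucc)) /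
            (lam (x i.castSucc) * ζ + mu (x i.castSucc) * ζ⁻¹ + 1)) := by
    intro i
    have := hGq (x i.castSucc)
    have := hrpos (x i.castSucc)
    rw [hα1, lintegral_exp_expMeasure (hq _) (by linarith)]
    congr 2
    linarith
  simp only [hA]
  -- When Gp is the tilt, the denominator is λ ζ + μ ζ⁻¹, at least (λ + μ) / Ξ; otherwise Gp = 0 and
  -- the integral is 1.
  have hB : ∫⁻ s, ENNReal.ofReal (Real.exp (Gp * s))
      ∂(expMeasure (lam (x (Fin.last n)) + mu (x (Fin.last n)))) ≤ ENNReal.ofReal Ξ := by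
    have h1 := hGq (x (Fin.last n))
    have h2 := hrpos (x (Fin.last n))
    have h3 := hq (x (Fin.last n))
    have h4 := hlam (x (Fin.last n))
    have h5 := hmu (x (Fin.last n))
    have h6 : Gp < lam (x (Fin.last n)) + mu (x (Fin.last n)) := max_lt (by linarith) h3
    rw [lintegral_exp_expMeasure h3 h6]
    refine ENNReal.ofReal_le_ofReal ?_
    rw [div_le_iff₀ (by linarith)]
    rcases max_choice (G (x (Fin.last n))) 0 with hc | hc
    · rw [hGp, hc, h1]
      have h7 : 1 ≤ Ξ * ζ := by
        calc (1 : ℝ) = ζ⁻¹ * ζ := (inv_mul_cancel₀ hζ.ne').symm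
          _ ≤ _ := by gcongr; exact le_max_right _ _
      have h8 : 1 ≤ Ξ * ζ⁻¹ := by
        calc (1 : ℝ) = ζ * ζ⁻¹ := (mul_inv_cancel₀ hζ.ne').symm
          _ ≤ _ := by gcongr; exact le_max_left _ _
      nlinarith
    · rw [hGp, hc, sub_zero]
      exact le_mul_of_one_le_left h3.le hΞ1
  calc _ ≤ ENNReal.ofReal C * (pathWeight lam mu x * ((∏ i : Fin n, ENNReal.ofReal
          ((lam (x i.castSucc) + mu (x i.castSucc)) /
            (lam (x i.castSucc) * ζ + mu (x i.castSucc) * ζ⁻¹ + 1))) * ENNReal.ofReal Ξ)) := by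
        gcongr
    _ = _ := by
        rw [hC, ENNReal.ofReal_mul (q := ζ ^ x (Fin.last n)) (by positivity),
          ENNReal.ofReal_mul (q := Ξ) (by positivity)]
        generalize (∏ i : Fin n, ENNReal.ofReal
          ((lam (x i.castSucc) + mu (x i.castSucc)) /
            (lam (x i.castSucc) * ζ + mu (x i.castSucc) * ζ⁻¹ + 1))) = p
        ring

/-- An exponential bound for the probability that the integral of `tilt lam mu ζ` along a
trajectory staying below `K` is large. -/
theorem measure_costEvent_le (H : JumpHoldLaw P lam mu X S) [IsProbabilityMeasure P]
    (hlam : ∀ x, 0 < lam x) (hmu : ∀ x, 0 ≤ mu x) (hmu0 : mu 0 = 0) {ζ : ℝ} (hζ : 0 < ζ)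
    (K : ℕ) (L T : ℝ) {R : ℝ} (hR : ∀ x ≤ K, lam x * ζ + mu x * ζ⁻¹ ≤ R) :
    P (⋃ n, costEvent X S (tilt lam mu ζ) K L T n) ≤
      ENNReal.ofReal (Real.exp (T - L) * max ζ ζ⁻¹ ^ K * max ζ ζ⁻¹ * (R + 1)) := by
  have hζ' : 0 < ζ⁻¹ := inv_pos.2 hζ
  have hq : ∀ x, 0 < lam x + mu x := fun x => add_pos_of_pos_of_nonneg (hlam x) (hmu x)
  have hrpos : ∀ x, 0 < lam x * ζ + mu x * ζ⁻¹ := fun x =>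
    add_pos_of_pos_of_nonneg (mul_pos (hlam x) hζ) (mul_nonneg (hmu x) hζ'.le)
  have hR0 : 0 < R := (hrpos 0).trans_le (hR 0 (Nat.zero_le _))
  set D := ENNReal.ofReal (Real.exp (T - L) * max ζ ζ⁻¹ ^ K * max ζ ζ⁻¹) with hD
  -- Write r = λ ζ + μ ζ⁻¹. The kernel maps ζ ^ x to r / (r + 1) times ζ ^ x; killing it above K,
  -- where r is no longer bounded by R, gives the uniform contraction ρ = R / (R + 1).
  set k : ℕ → ℕ → ENNReal := fun x x' => if x ≤ K then
    ENNReal.ofReal (jumpProb lam mu x x') *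
      ENNReal.ofReal ((lam x + mu x) / (lam x * ζ + mu x * ζ⁻¹ + 1)) else 0 with hk
  set h : ℕ → ENNReal := fun x => ENNReal.ofReal (ζ ^ x) with hh
  set ρ : ENNReal := ENNReal.ofReal (R / (R + 1)) with hρ
  have hstep : ∀ x, ∑' x', k x x' * h x' ≤ ρ * h x := by
    intro x
    by_cases hx : x ≤ K
    · have h1 : ∀ x', k x x' * h x' =
          ENNReal.ofReal ((lam x + mu x) / (lam x * ζ + mu x * ζ⁻¹ + 1)) *
          (ENNReal.ofReal (jumpProb lam mu x x') * ENNReal.ofReal (ζ ^ x')) := fun x' => by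
        simp only [hk, hh, if_pos hx]; ring
      have hr := hrpos x
      simp only [h1]
      rw [ENNReal.tsum_mul_left, tsum_jumpProb_mul hlam hmu hmu0 (fun x => by positivity),
        hρ, hh, ← ENNReal.ofReal_mul (div_nonneg (hq x).le (by linarith)),
        ← ENNReal.ofReal_mul (by positivity)]
      refine ENNReal.ofReal_le_ofReal ?_
      -- At x = 0 the truncated subtraction is harmless because `mu 0 = 0`.
      have h2 : lam x * ζ ^ (x + 1) + mu x * ζ ^ (x - 1) =
          (lam x * ζ + mu x * ζ⁻¹) * ζ ^ x := by
        cases x with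
        | zero => simp [hmu0]
        | succ x =>
          rw [Nat.add_sub_cancel]
          field_simp
          ring
      rw [h2]
      have hq' := (hq x).ne'
      calc _ = (lam x * ζ + mu x * ζ⁻¹) / (lam x * ζ + mu x * ζ⁻¹ + 1) * ζ ^ x := by
            field_simp
        _ ≤ R / (R + 1) * ζ ^ x := by
            refine mul_le_mul_of_nonneg_right ?_ (by positivity)
            rw [div_le_div_iff₀ (by linarith) (by linarith)]
            nlinarith [hR x hx]
    · simp [hk, hx]
  have hn : ∀ n, P (costEvent X S (tilt lam mu ζ) K L T n) ≤ D * ρ ^ n := by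
    intro n
    have h1 : P (costEvent X S (tilt lam mu ζ) K L T n) ≤ ∑' x : Fin (n + 1) → ℕ,
        P (costEvent X S (tilt lam mu ζ) K L T n ∩ {ω | ∀ i : Fin (n + 1), X i ω = x i}) := by
      refine (measure_mono fun ω hω => ?_).trans (measure_iUnion_le _)
      exact mem_iUnion.2 ⟨fun i => X i ω, hω, fun i => rfl⟩
    refine h1.trans ?_
    have h2 : ∀ x : Fin (n + 1) → ℕ,
        P (costEvent X S (tilt lam mu ζ) K L T n ∩ {ω | ∀ i : Fin (n + 1), X i ω = x i}) ≤
        D * (((if x 0 = 0 then 1 else 0) * ∏ i : Fin n, k (x i.castSucc) (x i.succ)) *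
          h (x (Fin.last n))) := by
      intro x
      by_cases hx : ∀ i, x i ≤ K
      · refine (H.measure_costEvent_path_le hlam hmu hmu0 hζ K L T x hx).trans_eq ?_
        simp only [hk, hx, if_true, Finset.prod_mul_distrib, pathWeight]
        ring
      · push Not at hx
        obtain ⟨i, hi⟩ := hx
        have : costEvent X S (tilt lam mu ζ) K L T n ∩ {ω | ∀ i : Fin (n + 1), X i ω = x i} = ∅ := by
          refine eq_empty_of_forall_notMem fun ω hω => ?_
          have h3 := hω.1.1 i (Nat.lt_succ_iff.1 i.2)
          rw [hω.2 i] at h3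
          omega
        rw [this, measure_empty]
        exact zero_le
    refine (ENNReal.tsum_le_tsum h2).trans ?_
    rw [ENNReal.tsum_mul_left]
    refine mul_le_mul_right ?_ _
    have := pathSum_le hstep n
    simpa [hh, pathSum] using this
  refine (measure_iUnion_le _).trans ((ENNReal.tsum_le_tsum hn).trans ?_)
  -- The series sums to 1 / (1 - ρ) = R + 1.
  rw [ENNReal.tsum_mul_left, ENNReal.tsum_geometric, hD, hρ, ← ENNReal.ofReal_one,
    ← ENNReal.ofReal_sub _ (by positivity), ← ENNReal.ofReal_inv_of_pos,
    ← ENNReal.ofReal_mul (by positivity)]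
  · refine ENNReal.ofReal_le_ofReal (le_of_eq ?_)
    congr 1
    field_simp
    ring
  · rw [sub_pos, div_lt_one (by linarith)]; linarith

end JumpHoldLaw

/-! ### Trajectories: from the tube to the cost integral. -/

/-- The trajectory `w` visits the states `x 0, x 1, …`, with holding times `s 0, s 1, …`, and is
sent to `⊤` at the explosion time. -/
structure IsTrajectory (x : ℕ → ℕ) (s : ℕ → ℝ) (w : ℝ → ℕ∞) : Prop where
  eq_coe : ∀ (n : ℕ) (t : ℝ), jumpTime s n ≤ t → t < jumpTime s (n + 1) → w t = (x n : ℕ∞)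
  eq_top : ∀ t : ℝ, (∀ n, jumpTime s n ≤ t) → w t = ⊤

theorem jumpTime_succ (s : ℕ → ℝ) (n : ℕ) : jumpTime s (n + 1) = jumpTime s n + s n :=
  Finset.sum_range_succ _ _

theorem jumpTime_zero (s : ℕ → ℝ) : jumpTime s 0 = 0 := Finset.sum_range_zero _

theorem jumpTime_mono {s : ℕ → ℝ} (hs : ∀ i, 0 < s i) : Monotone (jumpTime s) :=
  monotone_nat_of_le_succ fun n => by rw [jumpTime_succ]; linarith [hs n]

theorem jumpTime_nonneg {s : ℕ → ℝ} (hs : ∀ i, 0 < s i) (n : ℕ) : 0 ≤ jumpTime s n :=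
  Finset.sum_nonneg fun i _ => (hs i).le

/-- If the trajectory has not exploded at time `t`, then `t` lies between two jump times. -/
theorem IsTrajectory.exists_jump {x : ℕ → ℕ} {s : ℕ → ℝ} {w : ℝ → ℕ∞} (h : IsTrajectory x s w)
    {t : ℝ} (ht : 0 ≤ t) (hw : w t ≠ ⊤) : ∃ n, jumpTime s n ≤ t ∧ t < jumpTime s (n + 1) := by
  have h1 : ∃ n, t < jumpTime s n := by
    by_contra! hc
    exact hw (h.eq_top t hc)
  classical
  obtain ⟨n, hn⟩ : ∃ n, Nat.find h1 = n + 1 := Nat.exists_eq_succ_of_ne_zero (by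
    intro h0
    have := Nat.find_spec h1
    rw [h0, jumpTime_zero] at this
    linarith)
  refine ⟨n, not_lt.1 (Nat.find_min h1 (by omega)), ?_⟩
  have := Nat.find_spec h1
  rwa [hn] at this

theorem integral_le_pathIntegral {G : ℕ → ℝ} {x : ℕ → ℕ} {s : ℕ → ℝ} (hs : ∀ i, 0 < s i)
    {T : ℝ} {n : ℕ} (hn : jumpTime s n ≤ T) (hn' : T < jumpTime s (n + 1)) {g : ℝ → ℝ}
    (hg : ContinuousOn g (Icc 0 T))
    (hgG : ∀ i ≤ n, ∀ t, jumpTime s i ≤ t → t < jumpTime s (i + 1) → t ≤ T → g t ≤ G (x i)) :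
    ∫ t in (0 : ℝ)..T, g t ≤ pathIntegral G x s n T := by
  have hint : ∀ a b, 0 ≤ a → a ≤ b → b ≤ T → IntervalIntegrable g volume a b := fun a b ha hab hb =>
    (hg.mono (Icc_subset_Icc ha hb)).intervalIntegrable_of_Icc hab
  have hpiece : ∀ i ≤ n, ∀ b, jumpTime s i ≤ b → b ≤ jumpTime s (i + 1) → b ≤ T →
      ∫ t in jumpTime s i..b, g t ≤ G (x i) * (b - jumpTime s i) := by
    intro i hi b hb hb' hbT
    have h1 : ∫ t in jumpTime s i..b, g t ≤ ∫ t in jumpTime s i..b, G (x i) := by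
      -- Open intervals suffice, and avoid the right endpoint, where the state has already changed.
      refine intervalIntegral.integral_mono_on_of_le_Ioo hb
        (hint _ _ (jumpTime_nonneg hs i) hb hbT) intervalIntegrable_const fun t ht => ?_
      exact hgG i hi t ht.1.le (ht.2.trans_le hb') (ht.2.le.trans hbT)
    rw [intervalIntegral.integral_const, smul_eq_mul] at h1
    linarith
  have hsum : ∀ k ≤ n, ∫ t in (0 : ℝ)..jumpTime s k, g t ≤
      ∑ i ∈ Finset.range k, G (x i) * s i := by
    intro k
    induction k with
    | zero => intro _; simp [jumpTime_zero]
    | succ k ih =>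
      intro hk
      have hkT : jumpTime s (k + 1) ≤ T := (jumpTime_mono hs hk).trans hn
      have hk1 : jumpTime s k ≤ jumpTime s (k + 1) := jumpTime_mono hs (Nat.le_succ k)
      rw [Finset.sum_range_succ, ← intervalIntegral.integral_add_adjacent_intervals
        (hint _ _ le_rfl (jumpTime_nonneg hs k) (hk1.trans hkT))
        (hint _ _ (jumpTime_nonneg hs k) hk1 hkT)]
      have h2 := hpiece k (by omega) _ hk1 le_rfl hkT
      rw [jumpTime_succ s k, add_sub_cancel_left, ← jumpTime_succ s k] at h2
      linarith [ih (by omega)]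
  rw [pathIntegral, ← intervalIntegral.integral_add_adjacent_intervals
    (hint _ _ le_rfl (jumpTime_nonneg hs n) hn) (hint _ _ (jumpTime_nonneg hs n) hn le_rfl)]
  linarith [hsum n le_rfl, hpiece n le_rfl T hn hn'.le le_rfl]

theorem abs_sub_lt_of_mem_tubeEvent {Ω : Type*} {ξ : ℝ → Ω → ℕ∞} {φ : ℝ → ℝ}
    {T : ℝ} {f : ℝ → ℝ} {ε : ℝ} [MeasurableSpace Ω] {ω : Ω} (h : ω ∈ tubeEvent ξ φ T f ε) {t : ℝ}
    (ht : t ∈ Icc (0 : ℝ) 1) : |((ξ (t * T) ω).toNat : ℝ) / φ T - f t| < ε := by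
  have h1 := (le_iSup₂ (f := fun (t : ℝ) (_ : t ∈ Icc (0 : ℝ) 1) =>
    edist (((ξ (t * T) ω).toNat : ℝ) / φ T) (f t)) t ht).trans_lt h.2
  rw [edist_dist, Real.dist_eq, ENNReal.ofReal_lt_ofReal_iff'] at h1
  exact h1.1

/-- Absence of explosion at T yields a finite number n of jumps; each state visited up to then is
compared with f at the times when it is occupied, rescaled by T. -/
theorem mem_costEvent_of_mem_tubeEvent {Ω : Type*} [MeasurableSpace Ω] {X : ℕ → Ω → ℕ}
    {S : ℕ → Ω → ℝ} {ξ : ℝ → Ω → ℕ∞} {φ : ℝ → ℝ} {T : ℝ} {f : ℝ → ℝ} {ε : ℝ} {ω : Ω}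
    (hS : ∀ i, 0 < S i ω) (hξ : IsTrajectory (fun i => X i ω) (fun i => S i ω) (fun t => ξ t ω))
    (hT : 0 < T) {g : ℝ → ℝ} (hg : ContinuousOn g (Icc 0 1)) {G : ℕ → ℝ} {K : ℕ}
    (hgG : ∀ t ∈ Icc (0 : ℝ) 1, ∀ n : ℕ, |n / φ T - f t| < ε → n ≤ K ∧ g t ≤ G n)
    (h : ω ∈ tubeEvent ξ φ T f ε) :
    ω ∈ ⋃ n, costEvent X S G K (T * ∫ t in (0 : ℝ)..1, g t) T n := by
  set s : ℕ → ℝ := fun i => S i ω with hs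
  obtain ⟨n, hn, hn'⟩ := hξ.exists_jump hT.le (by
    have := h.1 1 ⟨zero_le_one, le_rfl⟩
    rwa [one_mul] at this)
  have key : ∀ i ≤ n, ∀ t, jumpTime s i ≤ t → t < jumpTime s (i + 1) → t ≤ T →
      X i ω ≤ K ∧ g (t / T) ≤ G (X i ω) := by
    intro i hi t ht ht' htT
    have ht0 : 0 ≤ t := (jumpTime_nonneg hS i).trans ht
    have htT' : t / T ∈ Icc (0 : ℝ) 1 := ⟨by positivity, (div_le_one hT).2 htT⟩
    have h1 := abs_sub_lt_of_mem_tubeEvent h htT'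
    have h2 := hξ.eq_coe i t ht ht'
    rw [div_mul_cancel₀ _ hT.ne', h2, ENat.toNat_natCast] at h1
    exact hgG _ htT' _ h1
  have hiT : ∀ i ≤ n, jumpTime s i ≤ T := fun i hi => (jumpTime_mono hS hi).trans hn
  refine mem_iUnion.2 ⟨n, fun i hi => ?_, hn, hn', ?_⟩
  · refine (key i hi (jumpTime s i) le_rfl ?_ (hiT i hi)).1
    rw [jumpTime_succ]; linarith [hS i]
  · have hg' : ContinuousOn (fun t => g (t / T)) (Icc 0 T) := by
      refine hg.comp (by fun_prop) fun t ht => ⟨div_nonneg ht.1 hT.le, (div_le_one hT).2 ht.2⟩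
    have h3 := integral_le_pathIntegral (G := G) (x := fun i => X i ω) hS hn hn' hg'
      fun i hi t ht ht' htT => (key i hi t ht ht' htT).2
    refine le_trans (le_of_eq ?_) h3
    rw [intervalIntegral.integral_comp_div (fun t => g t) hT.ne', zero_div, div_self hT.ne',
      smul_eq_mul]

/-! ### The upper bound. -/

/-- Powers depend uniformly continuously on a bounded base. -/
theorem rpow_uniform {p : ℝ} (hp : 0 < p) (B : ℝ) {δ : ℝ} (hδ : 0 < δ) :
    ∃ ε0 : ℝ, 0 < ε0 ∧ ε0 ≤ 1 ∧ ∀ u v : ℝ, 0 ≤ u → u ≤ B → 0 ≤ v → |v - u| < ε0 →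
      |v ^ p - u ^ p| < δ := by
  have hc : ContinuousOn (fun u : ℝ => u ^ p) (Icc 0 (B + 1)) :=
    (Real.continuous_rpow_const hp.le).continuousOn
  obtain ⟨ε, hε, h⟩ := Metric.uniformContinuousOn_iff.1
    (isCompact_Icc.uniformContinuousOn_of_continuous hc) δ hδ
  refine ⟨min ε 1, lt_min hε one_pos, min_le_right _ _, fun u v hu huB hv huv => ?_⟩
  have h1 : v ≤ B + 1 := by
    have := (abs_lt.1 (huv.trans_le (min_le_right _ _))).2
    linarith
  exact h v ⟨hv, h1⟩ u ⟨hu, by linarith⟩ (huv.trans_le (min_le_left _ _))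

/-- The cost of staying close to the level `u x`, in the scale `x`, is at least `u ^ p V x` per
unit of time. -/
theorem tilt_lower_bound {lam mu : ℕ → ℝ} {p : ℝ} (hp : 0 < p) {V : ℝ → ℝ}
    (hVinf : Tendsto V atTop atTop)
    (hU : ∀ δ : ℝ, 0 < δ → ∀ b : ℝ, ∀ᶠ x in atTop, ∀ n : ℕ, (n : ℝ) ≤ b * x →
      |(lam n + mu n) / V x - (n / x) ^ p| ≤ δ)
    (hG : ∀ η : ℝ, 0 < η → ∃ ζ : ℝ, 0 < ζ ∧ ∃ C : ℝ, 0 ≤ C ∧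
        ∀ n, (1 - η) * (lam n + mu n) ≤ lam n * (1 - ζ) + mu n * (1 - ζ⁻¹) + C)
    {B : ℝ} (hB : 0 ≤ B) {δ : ℝ} (hδ : 0 < δ) :
    ∃ ζ : ℝ, 0 < ζ ∧ ∃ ε0 : ℝ, 0 < ε0 ∧ ε0 ≤ 1 ∧ ∀ᶠ x in atTop, ∀ u : ℝ, 0 ≤ u → u ≤ B →
      ∀ n : ℕ, |n / x - u| < ε0 → V x * (u ^ p - δ) ≤ tilt lam mu ζ n := by
  obtain ⟨ε0, hε0, hε01, hpow⟩ := rpow_uniform hp B (show 0 < δ / 4 by linarith)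
  have hBp : 0 ≤ B ^ p := Real.rpow_nonneg hB p
  -- The loss δ is made of four quarters: scaling of the rates, continuity of the power, the factor
  -- 1 - η (whence η B ^ p ≤ δ / 4), and the constant C, negligible once V x ≥ 4 C / δ.
  set η := min (1 / 2) (δ / (4 * (B ^ p + 1))) with hη
  have hη0 : 0 < η := by positivity
  have hη1 : η ≤ 1 / 2 := min_le_left _ _
  have hη2 : η * B ^ p ≤ δ / 4 := by
    calc η * B ^ p ≤ δ / (4 * (B ^ p + 1)) * (B ^ p + 1) := by
          gcongr
          · exact min_le_right _ _
          · linarith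
      _ = δ / 4 := by field_simp
  obtain ⟨ζ, hζ, C, hC, hζC⟩ := hG η hη0
  refine ⟨ζ, hζ, ε0, hε0, hε01, ?_⟩
  filter_upwards [hU (δ / 4) (by linarith) (B + 1), hVinf.eventually_ge_atTop (max 1 (4 * C / δ)),
    eventually_gt_atTop 0] with x hx hV hx0 u hu huB n hn
  have hV1 : 1 ≤ V x := (le_max_left _ _).trans hV
  have hVC : C ≤ V x * (δ / 4) := by
    have := (le_max_right _ _).trans hV
    rw [div_le_iff₀ hδ] at this
    linarith
  have hnx : (n : ℝ) ≤ (B + 1) * x := by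
    have := (abs_lt.1 hn).2
    rw [← div_le_iff₀ hx0]
    linarith
  have h1 := (abs_le.1 (hx n hnx)).1
  have h2 := (abs_lt.1 (hpow u (n / x) hu huB (by positivity) hn)).1
  have h3 : V x * (u ^ p - δ / 2) ≤ lam n + mu n := by
    have : u ^ p - δ / 2 ≤ (lam n + mu n) / V x := by linarith
    rw [le_div_iff₀ (by linarith)] at this
    linarith
  have h4 := hζC n
  have h5 : u ^ p ≤ B ^ p := Real.rpow_le_rpow hu huB hp.le
  have h6 : (1 - η) * (V x * (u ^ p - δ / 2)) ≤ (1 - η) * (lam n + mu n) :=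
    mul_le_mul_of_nonneg_left h3 (by linarith)
  have h7 : η * (u ^ p - δ / 2) ≤ δ / 4 := by nlinarith
  have h8 : V x * (η * (u ^ p - δ / 2)) ≤ V x * (δ / 4) :=
    mul_le_mul_of_nonneg_left h7 (by linarith)
  rw [tilt]
  nlinarith

/-- The upper bound in the local large deviation principle. -/
theorem tubeEvent_upper_bound {Ω : Type*} [MeasurableSpace Ω] {P : Measure Ω}
    [IsProbabilityMeasure P] {lam mu : ℕ → ℝ} {X : ℕ → Ω → ℕ} {S : ℕ → Ω → ℝ}
    (H : JumpHoldLaw P lam mu X S)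
    (hlam : ∀ x, 0 < lam x) (hmu : ∀ x, 0 ≤ mu x) (hmu0 : mu 0 = 0) {ξ : ℝ → Ω → ℕ∞}
    (hξ : ∀ᵐ ω ∂P, IsTrajectory (fun i => X i ω) (fun i => S i ω) (fun t => ξ t ω))
    {p : ℝ} (hp : 0 < p) {V : ℝ → ℝ} (hVinf : Tendsto V atTop atTop)
    (hU : ∀ δ : ℝ, 0 < δ → ∀ b : ℝ, ∀ᶠ x in atTop, ∀ n : ℕ, (n : ℝ) ≤ b * x →
      |(lam n + mu n) / V x - (n / x) ^ p| ≤ δ)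
    (hG : ∀ η : ℝ, 0 < η → ∃ ζ : ℝ, 0 < ζ ∧ ∃ C : ℝ, 0 ≤ C ∧
        ∀ n, (1 - η) * (lam n + mu n) ≤ lam n * (1 - ζ) + mu n * (1 - ζ⁻¹) + C)
    {φ : ℝ → ℝ} (hφ : Tendsto φ atTop atTop)
    (hφV : Tendsto (fun T : ℝ => φ T / (T * V (φ T))) atTop (𝓝 0))
    {f : ℝ → ℝ} (hf : f ∈ pathSet) {δ : ℝ} (hδ : 0 < δ) :
    ∀ᶠ ε in 𝓝[>] (0 : ℝ), ∀ᶠ T in atTop, P (tubeEvent ξ φ T f ε) ≤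
      ENNReal.ofReal (Real.exp (-(((∫ t in (0 : ℝ)..1, f t ^ p) - δ) * (T * V (φ T))))) := by
  obtain ⟨hfc, hf0, hfpos⟩ := hf
  have hfnn : ∀ t ∈ Icc (0 : ℝ) 1, 0 ≤ f t := by
    intro t ht
    rcases ht.1.eq_or_lt with h | h
    · rw [← h, hf0]
    · exact (hfpos t ⟨h, ht.2⟩).le
  obtain ⟨B, hBf⟩ := isCompact_Icc.bddAbove_image hfc
  have hfB : ∀ t ∈ Icc (0 : ℝ) 1, f t ≤ B := fun t ht => hBf (mem_image_of_mem f ht)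
  have hB : 0 ≤ B := (hfnn 0 ⟨le_rfl, zero_le_one⟩).trans (hfB 0 ⟨le_rfl, zero_le_one⟩)
  obtain ⟨ζ, hζ, ε0, hε0, hε01, hev⟩ :=
    tilt_lower_bound hp hVinf hU hG hB (show 0 < δ / 5 by linarith)
  set Ξ := max ζ ζ⁻¹ with hΞ
  have hΞ1 : 1 ≤ Ξ := one_le_max_inv hζ
  have hlogΞ : 0 ≤ Real.log Ξ := Real.log_nonneg hΞ1
  set c := Ξ * ((B + 1) ^ p + 1) with hc
  have hc0 : 0 < c := by positivity
  filter_upwards [Ioo_mem_nhdsGT hε0] with ε hε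
  have hsmall : 0 < δ / (5 * ((B + 1) * Real.log Ξ + 1)) := by positivity
  filter_upwards [hφ.eventually hev, hφ.eventually (hU 1 one_pos (B + 1)),
    (hVinf.comp hφ).eventually_ge_atTop (max 1 (5 / δ)), hφ.eventually_gt_atTop 0,
    eventually_ge_atTop (max 1 (max (5 * c / δ) (5 * Real.log Ξ / δ))),
    hφV.eventually (gt_mem_nhds hsmall)] with T h1 h2 h3 hφ0 h4 h5
  simp only [Function.comp] at h3
  have hT1 : 1 ≤ T := (le_max_left _ _).trans h4
  have hT0 : 0 < T := by linarith
  have hTc : 5 * c / δ ≤ T := (le_max_left _ _).trans ((le_max_right _ _).trans h4)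
  have hTΞ : 5 * Real.log Ξ / δ ≤ T := (le_max_right _ _).trans ((le_max_right _ _).trans h4)
  have hV1 : 1 ≤ V (φ T) := (le_max_left _ _).trans h3
  have hV2 : 5 / δ ≤ V (φ T) := (le_max_right _ _).trans h3
  set v := V (φ T) with hv
  have hTv : 0 < T * v := by positivity
  -- The tube has radius below ε0 ≤ 1, so B + 1 bounds the rescaled process.
  set K := ⌊(B + 1) * φ T⌋₊ with hK
  have hKle : (K : ℝ) ≤ (B + 1) * φ T := Nat.floor_le (by positivity)
  set g : ℝ → ℝ := fun t => v * (f t ^ p - δ / 5) with hg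
  have hfp : ContinuousOn (fun t => f t ^ p) (Icc 0 1) :=
    hfc.rpow_const fun t _ => Or.inr hp.le
  have hgc : ContinuousOn g (Icc 0 1) := continuousOn_const.mul (hfp.sub continuousOn_const)
  have hgG : ∀ t ∈ Icc (0 : ℝ) 1, ∀ n : ℕ, |n / φ T - f t| < ε → n ≤ K ∧ g t ≤ tilt lam mu ζ n := by
    intro t ht n hn
    have hn' := hn.trans hε.2
    refine ⟨Nat.le_floor ?_, h1 (f t) (hfnn t ht) (hfB t ht) n hn'⟩
    have := (abs_lt.1 hn').2
    rw [← div_le_iff₀ hφ0]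
    linarith [hfB t ht]
  have hsub : P (tubeEvent ξ φ T f ε) ≤
      P (⋃ n, costEvent X S (tilt lam mu ζ) K (T * ∫ t in (0 : ℝ)..1, g t) T n) := by
    refine measure_mono_ae ?_
    filter_upwards [hξ, H.hold_pos hlam hmu hmu0] with ω h6 h7 h8
    exact mem_costEvent_of_mem_tubeEvent h7 h6 hT0 hgc hgG h8
  have hR : ∀ x ≤ K, lam x * ζ + mu x * ζ⁻¹ ≤ c * v := by
    intro x hx
    have hxK : (x : ℝ) ≤ (B + 1) * φ T := le_trans (by exact_mod_cast hx) hKle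
    have h6 := (abs_le.1 (h2 x hxK)).2
    have h7 : ((x : ℝ) / φ T) ^ p ≤ (B + 1) ^ p :=
      Real.rpow_le_rpow (by positivity) ((div_le_iff₀ hφ0).2 hxK) hp.le
    have h8 : lam x + mu x ≤ ((B + 1) ^ p + 1) * v := by
      rw [← div_le_iff₀ (by linarith)]; linarith
    calc lam x * ζ + mu x * ζ⁻¹ ≤ lam x * Ξ + mu x * Ξ :=
          add_le_add (mul_le_mul_of_nonneg_left (le_max_left _ _) (hlam x).le)
            (mul_le_mul_of_nonneg_left (le_max_right _ _) (hmu x))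
      _ = Ξ * (lam x + mu x) := by ring
      _ ≤ Ξ * (((B + 1) ^ p + 1) * v) := by gcongr
      _ = c * v := by rw [hc]; ring
  refine (hsub.trans (H.measure_costEvent_le hlam hmu hmu0 hζ K _ T hR)).trans
    (ENNReal.ofReal_le_ofReal ?_)
  have hint : ∫ t in (0 : ℝ)..1, g t = v * ((∫ t in (0 : ℝ)..1, f t ^ p) - δ / 5) := by
    rw [hg, intervalIntegral.integral_const_mul, intervalIntegral.integral_sub
      (hfp.intervalIntegrable_of_Icc zero_le_one) intervalIntegrable_const]
    simp
  rw [hint]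
  set I := ∫ t in (0 : ℝ)..1, f t ^ p with hI
  have hΞpow : Ξ ^ K = Real.exp (K * Real.log Ξ) := by
    rw [mul_comm, Real.exp_mul, Real.exp_log (by linarith), Real.rpow_natCast]
  have hΞe : Ξ = Real.exp (Real.log Ξ) := (Real.exp_log (by linarith)).symm
  have hRe : c * v + 1 ≤ Real.exp (c * v) := Real.add_one_le_exp _
  -- The tilt has already lost δ / 5 of the normalization T v; the factors exp T, Ξ ^ K, Ξ and R + 1
  -- (with R = c v) lose at most another δ / 5 each.
  calc Real.exp (T - T * (v * (I - δ / 5))) * Ξ ^ K * Ξ * (c * v + 1)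
      ≤ Real.exp (T - T * (v * (I - δ / 5))) * Real.exp (K * Real.log Ξ) *
          Real.exp (Real.log Ξ) * Real.exp (c * v) := by
        rw [← hΞe, ← hΞpow]
        gcongr
    _ = Real.exp (T - T * (v * (I - δ / 5)) + K * Real.log Ξ + Real.log Ξ + c * v) := by
        simp only [Real.exp_add]
    _ ≤ _ := by
        rw [Real.exp_le_exp]
        have e1 : T ≤ δ / 5 * (T * v) := by
          rw [div_le_iff₀ hδ] at hV2
          nlinarith
        have e2 : K * Real.log Ξ ≤ δ / 5 * (T * v) := by
          rw [div_lt_iff₀ hTv] at h5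
          have h9 : K * Real.log Ξ ≤ φ T * ((B + 1) * Real.log Ξ + 1) := by nlinarith
          refine h9.trans ?_
          calc φ T * ((B + 1) * Real.log Ξ + 1) ≤
              δ / (5 * ((B + 1) * Real.log Ξ + 1)) * (T * v) * ((B + 1) * Real.log Ξ + 1) := by
                gcongr
            _ = δ / 5 * (T * v) := by field_simp
        have e3 : Real.log Ξ ≤ δ / 5 * (T * v) := by
          rw [div_le_iff₀ hδ] at hTΞ
          nlinarith
        have e4 : c * v ≤ δ / 5 * (T * v) := by
          rw [div_le_iff₀ hδ] at hTc
          nlinarith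
        have e5 : T - T * (v * (I - δ / 5)) = T - I * (T * v) + δ / 5 * (T * v) := by ring
        have e6 : -((I - δ) * (T * v)) = -(I * (T * v)) + 5 * (δ / 5 * (T * v)) := by ring
        rw [e5, e6]
        linarith


/-! ### The lower bound: a path near f and the probability of following it. -/

/-- Continuous functions vanishing at `0` are uniform limits of nonnegative Lipschitz functions
vanishing at `0`, when they are nonnegative. -/
theorem exists_lipschitz_near {f : ℝ → ℝ} (hf : ContinuousOn f (Icc 0 1)) (hf0 : f 0 = 0)
    (hfnn : ∀ t ∈ Icc (0 : ℝ) 1, 0 ≤ f t) {ε : ℝ} (hε : 0 < ε) :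
    ∃ (g : ℝ → ℝ) (L : ℝ), 1 ≤ L ∧ g 0 = 0 ∧ (∀ t, 0 ≤ g t) ∧
      (∀ t ∈ Icc (0 : ℝ) 1, |g t - f t| ≤ ε) ∧
      ∀ s ∈ Icc (0 : ℝ) 1, ∀ t ∈ Icc (0 : ℝ) 1, |g s - g t| ≤ L * |s - t| := by
  obtain ⟨p, hp⟩ := exists_polynomial_near_of_continuousOn 0 1 f hf (ε / 2) (half_pos hε)
  obtain ⟨C, hC⟩ := (p.contDiff_aeval (𝕜 := ℝ) 1).contDiffOn.exists_lipschitzOnWith (s := Icc (0 : ℝ) 1)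
    one_ne_zero (convex_Icc 0 1) isCompact_Icc
  have h0 := hp 0 ⟨le_rfl, zero_le_one⟩
  rw [hf0, sub_zero] at h0
  -- Subtracting p(0) restores the value 0 at the origin, for another ε / 2; the positive part
  -- increases neither the distance to the nonnegative f nor the Lipschitz constant.
  refine ⟨fun t => max (p.eval t - p.eval 0) 0, max C 1, le_max_right _ _, by simp,
    fun t => le_max_right _ _, fun t ht => ?_, fun s hs t ht => ?_⟩
  · have h1 := hp t ht
    have h2 : |max (p.eval t - p.eval 0) 0 - max (f t) 0| ≤ |p.eval t - p.eval 0 - f t| := by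
      simpa using abs_max_sub_max_le_abs (p.eval t - p.eval 0) (f t) 0
    rw [max_eq_left (hfnn t ht)] at h2
    refine h2.trans ?_
    rw [abs_le]
    rw [abs_lt] at h0 h1
    constructor <;> linarith
  · have h1 := hC.dist_le_mul s hs t ht
    rw [Real.dist_eq, Real.dist_eq] at h1
    have h2 := abs_max_sub_max_le_abs (p.eval s - p.eval 0) (p.eval t - p.eval 0) 0
    rw [sub_sub_sub_cancel_right] at h2
    exact h2.trans (h1.trans (mul_le_mul_of_nonneg_right (le_max_left _ _) (abs_nonneg _)))

/-- The nearest-neighbour path which, at each step, moves towards the target `γ`. -/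
noncomputable def track (γ : ℕ → ℝ) : ℕ → ℕ
  | 0 => 0
  | i + 1 => if (track γ i : ℝ) ≤ γ i then track γ i + 1 else track γ i - 1

/-- A downward move occurs only strictly above a nonnegative target, hence from a positive state, so
truncated subtraction never produces a pause. -/
theorem track_step {γ : ℕ → ℝ} {i : ℕ} (hγ : 0 ≤ γ i) :
    (track γ (i + 1) = track γ i + 1) ∨ (track γ i = track γ (i + 1) + 1) := by
  rw [track]
  split_ifs with h
  · exact Or.inl rfl
  · right
    have : track γ i ≠ 0 := by
      intro h0
      rw [h0] at h
      exact h (by simpa using hγ)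
    omega

/-- The correcting step has size 1 and the target moves by at most 1: an error in [-2, 0] or (0, 2]
stays within [-2, 2]. -/
theorem abs_track_sub_le {γ : ℕ → ℝ} {N : ℕ} (hγ0 : γ 0 = 0) (hγ : ∀ i < N, 0 ≤ γ i)
    (hstep : ∀ i < N, |γ (i + 1) - γ i| ≤ 1) : ∀ i ≤ N, |(track γ i : ℝ) - γ i| ≤ 2 := by
  intro i
  induction i with
  | zero => intro _; simp [track, hγ0]
  | succ i ih =>
    intro hi
    have h1 := abs_le.1 (ih (by omega))
    have h2 := abs_le.1 (hstep i (by omega))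
    rw [abs_le]
    by_cases h : (track γ i : ℝ) ≤ γ i
    · have h3 : (track γ (i + 1) : ℝ) = track γ i + 1 := by
        rw [track, if_pos h]; push_cast; ring
      rw [h3]
      constructor <;> linarith
    · have h3 : (track γ (i + 1) : ℝ) = track γ i - 1 := by
        rcases track_step (hγ i (by omega)) with h4 | h4
        · rw [track, if_neg h] at h4; omega
        · rw [h4]; push_cast; ring
      rw [h3]
      push Not at h
      constructor <;> linarith

theorem half_min_le_one_sub_exp_neg {u : ℝ} (hu : 0 ≤ u) : min u 1 / 2 ≤ 1 - Real.exp (-u) := by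
  have h1 : Real.exp (-u) ≤ (1 + u)⁻¹ := by
    rw [Real.exp_neg]
    exact inv_anti₀ (by linarith) (by linarith [Real.add_one_le_exp u])
  have h2 : min u 1 / 2 ≤ 1 - (1 + u)⁻¹ := by
    rw [le_sub_iff_add_le, ← le_sub_iff_add_le', inv_le_iff_one_le_mul₀ (by linarith)]
    rcases le_total u 1 with h | h
    · rw [min_eq_left h]; nlinarith
    · rw [min_eq_right h]; nlinarith
  linarith

namespace JumpHoldLaw

variable {Ω : Type*} [MeasurableSpace Ω] {P : Measure Ω} {lam mu : ℕ → ℝ}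
  {X : ℕ → Ω → ℕ} {S : ℕ → Ω → ℝ}

theorem measure_path_window (H : JumpHoldLaw P lam mu X S) [IsProbabilityMeasure P]
    (hlam : ∀ x, 0 < lam x) (hmu : ∀ x, 0 ≤ mu x) (hmu0 : mu 0 = 0)
    {n : ℕ} (x : Fin (n + 1) → ℕ) {a b : ℝ} (ha : 0 ≤ a) (hab : a ≤ b) :
    P {ω | ∀ i : Fin (n + 1), X i ω = x i ∧ S i ω ∈ Ioc a b} =
      pathWeight lam mu x * ∏ i, ENNReal.ofReal (Real.exp (-((lam (x i) + mu (x i)) * a)) -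
        Real.exp (-((lam (x i) + mu (x i)) * b))) := by
  have hq : ∀ x, 0 < lam x + mu x := fun x => add_pos_of_pos_of_nonneg (hlam x) (hmu x)
  have hprob : ∀ i, IsProbabilityMeasure (expMeasure (lam (x i) + mu (x i))) := fun i =>
    isProbabilityMeasure_expMeasure (hq _)
  have hmeas : Measurable fun ω (i : Fin (n + 1)) => S i ω :=
    measurable_pi_lambda _ fun i => H.measurable_hold _
  have h := congrArg (fun m => m (univ.pi fun _ : Fin (n + 1) => Ioc a b))
    (H.map_hold_restrict hlam hmu hmu0 x)
  simp only [Measure.smul_apply, Measure.pi_pi, smul_eq_mul, expMeasure_Ioc (hq _) ha hab] at h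
  rw [← h, Measure.map_apply hmeas (MeasurableSet.univ_pi fun i => measurableSet_Ioc),
    Measure.restrict_apply (hmeas (MeasurableSet.univ_pi fun i => measurableSet_Ioc))]
  congr 1
  ext ω
  simp only [mem_ofPred_eq, mem_inter_iff, mem_preimage, mem_univ_pi]
  rw [← forall_and]
  exact forall_congr' fun i => and_comm

/-- A window's probability factors as exp(-q a), the true cost, times the chance of ending within a
further θ a. The latter and the jump probability are each at least exp(-κ), whence the error 2 N κ.
-/
theorem le_measure_path_window (H : JumpHoldLaw P lam mu X S) [IsProbabilityMeasure P]
    (hlam : ∀ x, 0 < lam x) (hmu : ∀ x, 0 ≤ mu x) (hmu0 : mu 0 = 0)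
    {x : ℕ → ℕ} {N : ℕ} (hN : 0 < N) (hx0 : x 0 = 0) {a θ κ : ℝ} (ha : 0 ≤ a) (hθ : 0 ≤ θ)
    (hκ : 0 ≤ κ)
    (hjump : ∀ i < N, Real.exp (-κ) ≤ jumpProb lam mu (x i) (x (i + 1)))
    (hhold : ∀ i < N, Real.exp (-κ) ≤ 1 - Real.exp (-((lam (x i) + mu (x i)) * (θ * a)))) :
    ENNReal.ofReal (Real.exp (-(a * ∑ i ∈ Finset.range N, (lam (x i) + mu (x i)) + 2 * N * κ))) ≤
      P {ω | ∀ i < N, X i ω = x i ∧ S i ω ∈ Ioc a ((1 + θ) * a)} := by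
  obtain ⟨n, rfl⟩ : ∃ n, N = n + 1 := ⟨N - 1, by omega⟩
  have h := H.measure_path_window hlam hmu hmu0 (fun i : Fin (n + 1) => x i) ha
    (b := (1 + θ) * a) (by nlinarith)
  have hset : {ω | ∀ i < n + 1, X i ω = x i ∧ S i ω ∈ Ioc a ((1 + θ) * a)} =
      {ω | ∀ i : Fin (n + 1), X i ω = x i ∧ S i ω ∈ Ioc a ((1 + θ) * a)} := by
    ext ω
    exact ⟨fun hω i => hω i i.2, fun hω i hi => hω ⟨i, hi⟩⟩
  rw [hset, h]
  -- There are only N - 1 transitions among N states; one superfluous κ is given away.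
  have hw : ENNReal.ofReal (Real.exp (-((n + 1) * κ))) ≤
      pathWeight lam mu (fun i : Fin (n + 1) => x i) := by
    rw [pathWeight, if_pos (by simpa using hx0), one_mul]
    calc ENNReal.ofReal (Real.exp (-((n + 1) * κ)))
        ≤ ENNReal.ofReal (∏ i : Fin n, Real.exp (-κ)) := by
          rw [Finset.prod_const, Finset.card_univ, Fintype.card_fin, ← Real.exp_nat_mul]
          refine ENNReal.ofReal_le_ofReal (Real.exp_le_exp.2 ?_)
          linarith
      _ = ∏ i : Fin n, ENNReal.ofReal (Real.exp (-κ)) :=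
          ENNReal.ofReal_prod_of_nonneg fun i _ => (Real.exp_pos _).le
      _ ≤ _ := Finset.prod_le_prod' fun i _ => ENNReal.ofReal_le_ofReal (by
          simpa using hjump i (by omega))
  have hh : ENNReal.ofReal (Real.exp (-(a * ∑ i ∈ Finset.range (n + 1), (lam (x i) + mu (x i)) +
      (n + 1) * κ))) ≤ ∏ i : Fin (n + 1), ENNReal.ofReal
        (Real.exp (-((lam (x i) + mu (x i)) * a)) -
        Real.exp (-((lam (x i) + mu (x i)) * ((1 + θ) * a)))) := by
    have h1 : -(a * ∑ i ∈ Finset.range (n + 1), (lam (x i) + mu (x i)) + (n + 1) * κ) =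
        ∑ i : Fin (n + 1), (-((lam (x i) + mu (x i)) * a) - κ) := by
      rw [Finset.sum_range, Finset.sum_sub_distrib, Finset.sum_neg_distrib, ← Finset.sum_mul]
      simp
      ring
    rw [h1, Real.exp_sum, ENNReal.ofReal_prod_of_nonneg fun i _ => (Real.exp_pos _).le]
    refine Finset.prod_le_prod' fun i _ => ENNReal.ofReal_le_ofReal ?_
    have h2 : Real.exp (-((lam (x i) + mu (x i)) * ((1 + θ) * a))) =
        Real.exp (-((lam (x i) + mu (x i)) * a)) *
          Real.exp (-((lam (x i) + mu (x i)) * (θ * a))) := by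
      rw [← Real.exp_add]; congr 1; ring
    rw [h2, sub_eq_add_neg, Real.exp_add]
    have := mul_le_mul_of_nonneg_left (hhold i i.2)
      (Real.exp_pos (-((lam (x i) + mu (x i)) * a))).le
    linarith
  refine le_trans (le_of_eq ?_) (mul_le_mul' hw hh)
  rw [← ENNReal.ofReal_mul (Real.exp_pos _).le, ← Real.exp_add]
  congr 2
  push_cast
  ring

end JumpHoldLaw

/-- A trajectory following the path `x` with holding times close to `T / N` belongs to the tube
around `f`, if `x` is close to `f`. -/
theorem mem_tubeEvent_of_window {Ω : Type*} [MeasurableSpace Ω] {X : ℕ → Ω → ℕ}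
    {S : ℕ → Ω → ℝ} {ξ : ℝ → Ω → ℕ∞} {φ : ℝ → ℝ} {T : ℝ} {f : ℝ → ℝ} {ε : ℝ} {ω : Ω}
    (hξ : IsTrajectory (fun i => X i ω) (fun i => S i ω) (fun t => ξ t ω))
    (hT : 0 < T) {N : ℕ} (hN : 0 < N) {θ : ℝ} (hθ0 : 0 ≤ θ) (hθ : θ ≤ 1) (hε : 0 < ε) {x : ℕ → ℕ}
    (hclose : ∀ i < N, ∀ t ∈ Icc (0 : ℝ) 1, |t - i / N| ≤ θ + 2 / N → |x i / φ T - f t| ≤ ε / 2)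
    (hω : ∀ i < N, X i ω = x i ∧ S i ω ∈ Ioc (T / N) ((1 + θ) * (T / N))) :
    ω ∈ tubeEvent ξ φ T f ε := by
  set s : ℕ → ℝ := fun i => S i ω with hs
  have hN' : (0 : ℝ) < N := by exact_mod_cast hN
  have hlow : ∀ i ≤ N, i * (T / N) ≤ jumpTime s i := by
    intro i hi
    rw [jumpTime]
    have : ∑ j ∈ Finset.range i, T / N ≤ ∑ j ∈ Finset.range i, s j :=
      Finset.sum_le_sum fun j hj => (hω j (by have := Finset.mem_range.1 hj; omega)).2.1.le
    simpa using this
  have hup : ∀ i ≤ N, jumpTime s i ≤ i * ((1 + θ) * (T / N)) := by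
    intro i hi
    rw [jumpTime]
    have : ∑ j ∈ Finset.range i, s j ≤ ∑ j ∈ Finset.range i, (1 + θ) * (T / N) :=
      Finset.sum_le_sum fun j hj => (hω j (by have := Finset.mem_range.1 hj; omega)).2.2
    simpa using this
  -- Each window excludes its left end T / N, so N holding times strictly exceed T and no later
  -- state matters on [0, T].
  have hNT : T < jumpTime s N := by
    obtain ⟨n, rfl⟩ : ∃ n, N = n + 1 := ⟨N - 1, by omega⟩
    rw [jumpTime_succ]
    have h1 := hlow n (by omega)
    have h2 := (hω n (by omega)).2.1
    have h3 : (n : ℝ) * (T / (n + 1 : ℕ)) + T / (n + 1 : ℕ) = T := by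
      push_cast at hN' ⊢
      field_simp
    linarith
  have key : ∀ t ∈ Icc (0 : ℝ) 1, ∃ i < N, ξ (t * T) ω = (x i : ℕ∞) ∧
      |x i / φ T - f t| ≤ ε / 2 := by
    intro t ht
    have htT0 : 0 ≤ t * T := mul_nonneg ht.1 hT.le
    have htT : t * T ≤ T := by nlinarith [ht.2]
    have hex : ∃ n, t * T < jumpTime s n := ⟨N, htT.trans_lt hNT⟩
    classical
    obtain ⟨i, hi⟩ : ∃ n, Nat.find hex = n + 1 := Nat.exists_eq_succ_of_ne_zero (by
      intro h0
      have := Nat.find_spec hex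
      rw [h0, jumpTime_zero] at this
      linarith)
    have h1 : t * T < jumpTime s (i + 1) := hi ▸ Nat.find_spec hex
    have h2 : jumpTime s i ≤ t * T := not_lt.1 (Nat.find_min hex (by omega))
    have hiN : i < N := by
      have : Nat.find hex ≤ N := Nat.find_min' hex (htT.trans_lt hNT)
      omega
    refine ⟨i, hiN, ?_, hclose i hiN t ht ?_⟩
    · rw [hξ.eq_coe i _ h2 h1, (hω i hiN).1]
    -- State i is occupied within the rescaled times i / N and (i + 1)(1 + θ) / N; as i ≤ N and θ ≤
    -- 1, the delay after i / N is at most θ + 2 / N.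
    · have h3 := (hlow i hiN.le).trans h2
      have h4 := h1.trans_le (hup (i + 1) hiN)
      have h5 : (i : ℝ) / N ≤ t := by
        rw [div_le_iff₀ hN']
        have : (i : ℝ) * (T / N) * N ≤ t * T * N := mul_le_mul_of_nonneg_right h3 hN'.le
        rw [mul_assoc, div_mul_cancel₀ _ hN'.ne'] at this
        nlinarith
      have h6 : t ≤ (i + 1) * (1 + θ) / N := by
        rw [le_div_iff₀ hN']
        push_cast at h4
        have : t * T * N ≤ (i + 1) * ((1 + θ) * (T / N)) * N :=
          mul_le_mul_of_nonneg_right h4.le hN'.le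
        rw [show ((i : ℝ) + 1) * ((1 + θ) * (T / N)) * N = (i + 1) * (1 + θ) * T by
          field_simp] at this
        nlinarith
      have h7 : (i : ℝ) ≤ N := by exact_mod_cast hiN.le
      have h8 : ((i : ℝ) + 1) * (1 + θ) / N ≤ i / N + θ + 2 / N := by
        rw [div_add' _ _ _ hN'.ne', ← add_div]
        gcongr
        nlinarith
      rw [abs_of_nonneg (by linarith)]
      linarith
  refine ⟨fun t ht => ?_, ?_⟩
  · obtain ⟨i, -, h, -⟩ := key t ht
    rw [h]
    exact ENat.natCast_ne_top _
  -- A pointwise strict bound does not pass to the supremum, hence the margin ε / 2.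
  · refine lt_of_le_of_lt (b := ENNReal.ofReal (ε / 2)) ?_
      ((ENNReal.ofReal_lt_ofReal_iff hε).2 (by linarith))
    refine iSup₂_le fun t ht => ?_
    obtain ⟨i, -, h, h'⟩ := key t ht
    rw [h, ENat.toNat_natCast, edist_dist, Real.dist_eq]
    exact ENNReal.ofReal_le_ofReal h'

/-- A Riemann sum is at most the integral of a function dominating it on each subinterval. -/
theorem sum_le_integral_of_le {F : ℝ → ℝ} (hF : ContinuousOn F (Icc 0 1)) {N : ℕ} (hN : 0 < N)
    {u : ℕ → ℝ} (hu : ∀ i < N, ∀ t ∈ Icc (0 : ℝ) 1, |t - i / N| ≤ 1 / N → u i ≤ F t) :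
    (∑ i ∈ Finset.range N, u i) / N ≤ ∫ t in (0 : ℝ)..1, F t := by
  have hN' : (0 : ℝ) < N := by exact_mod_cast hN
  have hsub : ∀ i < N, Icc ((i : ℝ) / N) ((i + 1 : ℕ) / N) ⊆ Icc 0 1 := by
    intro i hi
    refine Icc_subset_Icc (by positivity) ?_
    rw [div_le_one hN']
    exact_mod_cast hi
  have hle : ∀ i : ℕ, (i : ℝ) / N ≤ (i + 1 : ℕ) / N := fun i => by
    gcongr
    exact_mod_cast Nat.le_succ i
  have hint : ∀ i < N, IntervalIntegrable F volume ((i : ℝ) / N) ((i + 1 : ℕ) / N) := fun i hi =>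
    (hF.mono (hsub i hi)).intervalIntegrable_of_Icc (hle i)
  have h := intervalIntegral.sum_integral_adjacent_intervals (a := fun i : ℕ => (i : ℝ) / N) hint
  simp only [Nat.cast_zero, zero_div, div_self hN'.ne'] at h
  rw [← h, Finset.sum_div]
  refine Finset.sum_le_sum fun i hi => ?_
  have hi' := Finset.mem_range.1 hi
  have h1 : ∫ t in ((i : ℝ) / N)..((i + 1 : ℕ) / N), u i ≤
      ∫ t in ((i : ℝ) / N)..((i + 1 : ℕ) / N), F t := by
    refine intervalIntegral.integral_mono_on (hle i) intervalIntegrable_const (hint i hi')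
      fun t ht => hu i hi' t (hsub i hi' ht) ?_
    rw [abs_of_nonneg (by linarith [ht.1])]
    have := ht.2
    push_cast at this
    rw [add_div] at this
    linarith
  rw [intervalIntegral.integral_const, smul_eq_mul, ← sub_div] at h1
  push_cast at h1
  rw [add_sub_cancel_left] at h1
  push_cast
  calc u i / N = 1 / N * u i := by ring
    _ ≤ _ := h1

/-- In the scale `x`, the probabilities of a given jump and of a given holding time window are
at least a power of `1 / x`. -/
theorem polynomial_step_bounds {lam mu : ℕ → ℝ} (hlam : ∀ x, 0 < lam x) (hmu : ∀ x, 0 ≤ mu x)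
    (hmupos : ∀ x, 1 ≤ x → 0 < mu x)
    {K : ℝ} (hK : 0 ≤ K) (hlogl : ∀ n : ℕ, |Real.log (lam n)| ≤ K * Real.log (n + 2))
    (hlogm : ∀ n : ℕ, |Real.log (mu n)| ≤ K * Real.log (n + 2))
    (hlogq : ∀ n : ℕ, |Real.log (lam n + mu n)| ≤ K * Real.log (n + 2))
    {b θ L : ℝ} (hb : 0 ≤ b) (hθ : 0 < θ) :
    ∀ᶠ x : ℝ in atTop, ∀ n : ℕ, (n : ℝ) ≤ b * x →
      (∀ n' : ℕ, (n' = n + 1 ∨ n = n' + 1) →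
        Real.exp (-((4 * K + 2) * Real.log x)) ≤ jumpProb lam mu n n') ∧
      ∀ (T : ℝ) (N : ℕ), 1 ≤ T → 0 < N → (N : ℝ) ≤ L * x →
        Real.exp (-((4 * K + 2) * Real.log x)) ≤
          1 - Real.exp (-((lam n + mu n) * (θ * (T / N)))) := by
  filter_upwards [eventually_ge_atTop (b + 2), eventually_ge_atTop (2 * L / θ)] with x hx hxL n hn
  have hx2 : 2 ≤ x := by linarith
  have hx0 : 0 < x := by linarith
  set ℓ := Real.log x with hℓ
  have hℓ0 : 0 ≤ ℓ := Real.log_nonneg (by linarith)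
  have hn2 : Real.log (n + 2) ≤ 2 * ℓ := by
    have h1 : (n : ℝ) + 2 ≤ x ^ 2 := by nlinarith
    have h2 := Real.log_le_log (by positivity) h1
    rwa [Real.log_pow] at h2
  have hKn : K * Real.log (n + 2) ≤ 2 * K * ℓ := by nlinarith
  have hq : 0 < lam n + mu n := add_pos_of_pos_of_nonneg (hlam n) (hmu n)
  have hql := (abs_le.1 (hlogq n)).1
  have hqu := (abs_le.1 (hlogq n)).2
  have hratio : ∀ r : ℝ, 0 < r → |Real.log r| ≤ K * Real.log (n + 2) →
      Real.exp (-((4 * K + 2) * ℓ)) ≤ r / (lam n + mu n) := by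
    intro r hr hlr
    rw [← Real.le_log_iff_exp_le (by positivity), Real.log_div hr.ne' hq.ne']
    have := (abs_le.1 hlr).1
    nlinarith
  refine ⟨?_, fun T N hT hN hNL => ?_⟩
  · rintro n' (h | h)
    · rw [jumpProb, if_pos h]
      exact hratio _ (hlam n) (hlogl n)
    · rw [jumpProb, if_neg (by omega), if_pos h]
      exact hratio _ (hmupos n (by omega)) (hlogm n)
  · have hN' : (0 : ℝ) < N := by exact_mod_cast hN
    have he : Real.exp (-((2 * K + 2) * ℓ)) = Real.exp (-(2 * K * ℓ)) / x ^ 2 := by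
      rw [show -((2 * K + 2) * ℓ) = -(2 * K * ℓ) - (ℓ + ℓ) by ring, Real.exp_sub, Real.exp_add,
        hℓ, Real.exp_log hx0, sq]
    have hqe : Real.exp (-(2 * K * ℓ)) ≤ lam n + mu n := by
      rw [← Real.le_log_iff_exp_le hq]; linarith
    -- The factor 2 offsets the one lost in `half_min_le_one_sub_exp_neg`.
    have hTN : 2 / x ^ 2 ≤ θ * (T / N) := by
      have h1 : 2 * L ≤ x * θ := (div_le_iff₀ hθ).1 hxL
      rw [← mul_div_assoc, div_le_div_iff₀ (by positivity) hN']
      have h2 : 2 * (N : ℝ) ≤ θ * x ^ 2 := by nlinarith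
      have h3 : θ * x ^ 2 ≤ θ * T * x ^ 2 := by
        have : 0 < θ * x ^ 2 := by positivity
        nlinarith
      linarith
    have hu : 2 * Real.exp (-((2 * K + 2) * ℓ)) ≤ (lam n + mu n) * (θ * (T / N)) := by
      calc 2 * Real.exp (-((2 * K + 2) * ℓ)) = Real.exp (-(2 * K * ℓ)) * (2 / x ^ 2) := by
            rw [he]; ring
        _ ≤ _ := mul_le_mul hqe hTN (by positivity) hq.le
    have hone : 2 * Real.exp (-((2 * K + 2) * ℓ)) ≤ 1 := by
      rw [he]
      have h1 : Real.exp (-(2 * K * ℓ)) ≤ 1 := Real.exp_le_one_iff.2 (by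
        have : 0 ≤ 2 * K * ℓ := by positivity
        linarith)
      have h2 : Real.exp (-(2 * K * ℓ)) / x ^ 2 ≤ 1 / x ^ 2 := by gcongr
      have h3 : 1 / x ^ 2 ≤ 1 / 2 := by
        refine one_div_le_one_div_of_le two_pos ?_
        nlinarith
      linarith
    refine le_trans ?_ (half_min_le_one_sub_exp_neg (le_trans (by positivity) hu))
    have h1 := le_min hu hone
    have h2 : Real.exp (-((4 * K + 2) * ℓ)) ≤ Real.exp (-((2 * K + 2) * ℓ)) := by
      rw [Real.exp_le_exp]
      nlinarith [mul_nonneg hK hℓ0]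
    linarith

/-- Nearest-neighbour paths following the rescaled profile `f`. -/
theorem exists_path_near {f : ℝ → ℝ} (hf : f ∈ pathSet) {ε : ℝ} (hε : 0 < ε) :
    ∃ L θ : ℝ, 1 ≤ L ∧ 0 < θ ∧ θ ≤ 1 ∧ ∀ᶠ x : ℝ in atTop, ∃ (N : ℕ) (u : ℕ → ℕ), 0 < N ∧
      (N : ℝ) ≤ L * x ∧ u 0 = 0 ∧ (∀ i < N, u (i + 1) = u i + 1 ∨ u i = u (i + 1) + 1) ∧
      ∀ i < N, ∀ t ∈ Icc (0 : ℝ) 1, |t - i / N| ≤ θ + 2 / N → |u i / x - f t| ≤ ε := by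
  obtain ⟨hfc, hf0, hfpos⟩ := hf
  have hfnn : ∀ t ∈ Icc (0 : ℝ) 1, 0 ≤ f t := by
    intro t ht
    rcases ht.1.eq_or_lt with h | h
    · rw [← h, hf0]
    · exact (hfpos t ⟨h, ht.2⟩).le
  obtain ⟨g, L, hL, hg0, hgnn, hgf, hgL⟩ := exists_lipschitz_near hfc hf0 hfnn
    (show 0 < ε / 4 by linarith)
  have hL0 : 0 < L := by linarith
  -- The distance splits into four parts of at most ε / 4: approximation by g, tracking error 2 / x,
  -- delay L θ, and delay 2 L / N ≤ 2 / x.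
  refine ⟨2 * L, min 1 (ε / (4 * L)), by linarith, by positivity, min_le_left _ _, ?_⟩
  filter_upwards [eventually_ge_atTop 1, eventually_ge_atTop (8 / ε)] with x hx1 hxε
  have hx0 : 0 < x := by linarith
  -- With N ≥ L x, the scaled L-Lipschitz target moves by at most 1 per step; N ≤ 2 L x since L x ≥
  -- 1.
  set N := ⌈L * x⌉₊ with hN
  have hNL : L * x ≤ N := Nat.le_ceil _
  have hLx : 1 ≤ L * x := by nlinarith
  have hN' : (0 : ℝ) < N := by linarith
  have hN0 : 0 < N := by exact_mod_cast hN'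
  set γ : ℕ → ℝ := fun i => x * g (i / N) with hγ
  have hmem : ∀ i ≤ N, (i : ℝ) / N ∈ Icc (0 : ℝ) 1 := fun i hi =>
    ⟨by positivity, by rw [div_le_one hN']; exact_mod_cast hi⟩
  have hγnn : ∀ i, 0 ≤ γ i := fun i => mul_nonneg hx0.le (hgnn _)
  have hstep : ∀ i < N, |γ (i + 1) - γ i| ≤ 1 := by
    intro i hi
    have h1 := hgL _ (hmem (i + 1) hi) _ (hmem i hi.le)
    rw [← sub_div] at h1
    push_cast at h1
    rw [add_sub_cancel_left, abs_of_pos (one_div_pos.2 hN')] at h1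
    simp only [hγ]
    rw [← mul_sub, abs_mul, abs_of_pos hx0]
    push_cast
    calc x * |g ((i + 1) / N) - g (i / N)| ≤ x * (L * (1 / N)) := by gcongr
      _ = L * x / N := by ring
      _ ≤ 1 := (div_le_one hN').2 hNL
  have htrack := abs_track_sub_le (γ := γ) (N := N) (by simp [hγ, hg0]) (fun i _ => hγnn i) hstep
  refine ⟨N, track γ, hN0, ?_, rfl, fun i _ => track_step (hγnn i), ?_⟩
  · have := Nat.ceil_lt_add_one (show 0 ≤ L * x by linarith)
    linarith
  · intro i hi t ht hti
    have h1 : |(track γ i : ℝ) / x - g (i / N)| ≤ 2 / x := by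
      rw [le_div_iff₀ hx0, ← abs_of_pos hx0, ← abs_mul, abs_of_pos hx0, sub_mul,
        div_mul_cancel₀ _ hx0.ne', mul_comm (g _)]
      exact htrack i hi.le
    have h2 := hgL t ht _ (hmem i hi.le)
    have h3 := hgf t ht
    have h4 : L * |t - i / N| ≤ ε / 4 + 2 / x := by
      calc L * |t - i / N| ≤ L * (ε / (4 * L) + 2 / N) := by
            gcongr
            exact hti.trans (by gcongr; exact min_le_right _ _)
        _ = ε / 4 + 2 * L / N := by field_simp
        _ ≤ ε / 4 + 2 / x := by
            refine add_le_add le_rfl ?_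
            rw [div_le_div_iff₀ hN' hx0]
            linarith
    have h5 : 2 / x ≤ ε / 4 := by
      rw [div_le_iff₀ hε] at hxε
      rw [div_le_iff₀ hx0]
      linarith
    have h6 := abs_le.1 h1
    have h7 := abs_le.1 (h2.trans h4)
    have h8 := abs_le.1 h3
    rw [abs_le]
    constructor <;> linarith [h6.1, h6.2, h7.1, h7.2, h8.1, h8.2]

/-- The lower bound in the local large deviation principle. -/
theorem tubeEvent_lower_bound {Ω : Type*} [MeasurableSpace Ω] {P : Measure Ω}
    [IsProbabilityMeasure P] {lam mu : ℕ → ℝ} {X : ℕ → Ω → ℕ} {S : ℕ → Ω → ℝ}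
    (H : JumpHoldLaw P lam mu X S)
    (hlam : ∀ x, 0 < lam x) (hmu : ∀ x, 0 ≤ mu x) (hmu0 : mu 0 = 0)
    (hmupos : ∀ x, 1 ≤ x → 0 < mu x) {ξ : ℝ → Ω → ℕ∞}
    (hξ : ∀ᵐ ω ∂P, IsTrajectory (fun i => X i ω) (fun i => S i ω) (fun t => ξ t ω))
    {p : ℝ} (hp : 0 < p) {V : ℝ → ℝ} (hVinf : Tendsto V atTop atTop)
    (hU : ∀ δ : ℝ, 0 < δ → ∀ b : ℝ, ∀ᶠ x in atTop, ∀ n : ℕ, (n : ℝ) ≤ b * x →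
      |(lam n + mu n) / V x - (n / x) ^ p| ≤ δ)
    {K : ℝ} (hK : 0 ≤ K) (hlogl : ∀ n : ℕ, |Real.log (lam n)| ≤ K * Real.log (n + 2))
    (hlogm : ∀ n : ℕ, |Real.log (mu n)| ≤ K * Real.log (n + 2))
    (hlogq : ∀ n : ℕ, |Real.log (lam n + mu n)| ≤ K * Real.log (n + 2))
    {φ : ℝ → ℝ} (hφ : Tendsto φ atTop atTop)
    (hφV : Tendsto (fun T : ℝ => φ T * Real.log (φ T) / (T * V (φ T))) atTop (𝓝 0))
    {f : ℝ → ℝ} (hf : f ∈ pathSet) {δ : ℝ} (hδ : 0 < δ) {ε : ℝ} (hε : 0 < ε) :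
    ∀ᶠ T in atTop, ENNReal.ofReal
      (Real.exp (-(((∫ t in (0 : ℝ)..1, f t ^ p) + δ) * (T * V (φ T))))) ≤
        P (tubeEvent ξ φ T f ε) := by
  have hfc := hf.1
  have hfnn : ∀ t ∈ Icc (0 : ℝ) 1, 0 ≤ f t := by
    intro t ht
    rcases ht.1.eq_or_lt with h | h
    · rw [← h, hf.2.1]
    · exact (hf.2.2 t ⟨h, ht.2⟩).le
  obtain ⟨B, hBf⟩ := isCompact_Icc.bddAbove_image hfc
  have hfB : ∀ t ∈ Icc (0 : ℝ) 1, f t ≤ B := fun t ht => hBf (mem_image_of_mem f ht)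
  have hB : 0 ≤ B := (hfnn 0 ⟨le_rfl, zero_le_one⟩).trans (hfB 0 ⟨le_rfl, zero_le_one⟩)
  obtain ⟨ε0, hε0, hε01, hpow⟩ := rpow_uniform hp B (show 0 < δ / 3 by linarith)
  -- The first bound keeps the path in the tube, the second keeps its cost close to that of f.
  set ε1 := min (ε / 2) (ε0 / 2) with hε1
  have hε1pos : 0 < ε1 := lt_min (by linarith) (by linarith)
  have hε1a : ε1 ≤ ε / 2 := min_le_left _ _
  have hε1b : ε1 < ε0 := (min_le_right _ _).trans_lt (by linarith)
  obtain ⟨L, θ, hL, hθ0, hθ1, hpath⟩ := exists_path_near hf hε1pos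
  have hbounds := polynomial_step_bounds hlam hmu hmupos hK hlogl hlogm hlogq
    (b := B + 1) (L := L) (by linarith) hθ0
  have hsmall : 0 < δ / (3 * (2 * L * (4 * K + 2))) := by positivity
  filter_upwards [hφ.eventually hpath, hφ.eventually hbounds,
    hφ.eventually (hU (δ / 3) (by linarith) (B + 1)),
    (hVinf.comp hφ).eventually_ge_atTop 1, hφ.eventually_ge_atTop 1,
    eventually_ge_atTop 1, hφV.eventually (gt_mem_nhds hsmall)] with T h1 h2 h3 hV1 hφ1 hT1 h4
  simp only [Function.comp] at hV1
  obtain ⟨N, u, hN, hNL, hu0, hadj, hclose⟩ := h1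
  have hN' : (0 : ℝ) < N := by exact_mod_cast hN
  have hφ0 : 0 < φ T := by linarith
  have hT0 : 0 < T := by linarith
  set v := V (φ T) with hv
  have hTv : 0 < T * v := by positivity
  have hℓ0 : 0 ≤ Real.log (φ T) := Real.log_nonneg hφ1
  set κ := (4 * K + 2) * Real.log (φ T) with hκ
  have hκ0 : 0 ≤ κ := by positivity
  have hmem : ∀ i < N, (i : ℝ) / N ∈ Icc (0 : ℝ) 1 := fun i hi =>
    ⟨by positivity, by rw [div_le_one hN']; exact_mod_cast hi.le⟩
  have huB : ∀ i < N, (u i : ℝ) ≤ (B + 1) * φ T := by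
    intro i hi
    have h5 := (abs_le.1 (hclose i hi _ (hmem i hi) (by rw [sub_self, abs_zero]; positivity))).2
    rw [← div_le_iff₀ hφ0]
    linarith [hfB _ (hmem i hi)]
  have hF : ContinuousOn (fun t => v * (f t ^ p + 2 * (δ / 3))) (Icc 0 1) :=
    continuousOn_const.mul ((hfc.rpow_const fun t _ => Or.inr hp.le).add continuousOn_const)
  have hsum := sum_le_integral_of_le hF hN (u := fun i => lam (u i) + mu (u i)) (by
    intro i hi t ht hti
    have h5 := hclose i hi t ht (hti.trans (by
      have : (1 : ℝ) / N ≤ 2 / N := by gcongr; norm_num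
      linarith))
    have h6 := (abs_lt.1 (hpow (f t) (u i / φ T) (hfnn t ht) (hfB t ht) (by positivity)
      (h5.trans_lt hε1b))).2
    have h7 := (abs_le.1 (h3 (u i) (huB i hi))).2
    have h8 : (lam (u i) + mu (u i)) / v ≤ f t ^ p + 2 * (δ / 3) := by linarith
    rw [div_le_iff₀ (by linarith)] at h8
    linarith)
  have hint : ∫ t in (0 : ℝ)..1, v * (f t ^ p + 2 * (δ / 3)) =
      v * ((∫ t in (0 : ℝ)..1, f t ^ p) + 2 * (δ / 3)) := by
    rw [intervalIntegral.integral_const_mul, intervalIntegral.integral_add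
      ((hfc.rpow_const fun t _ => Or.inr hp.le).intervalIntegrable_of_Icc zero_le_one)
      intervalIntegrable_const]
    simp
  rw [hint] at hsum
  set I := ∫ t in (0 : ℝ)..1, f t ^ p with hI
  have hP := H.le_measure_path_window hlam hmu hmu0 hN hu0 (a := T / N) (θ := θ) (κ := κ)
    (by positivity) hθ0.le hκ0
    (fun i hi => (h2 (u i) (huB i hi)).1 _ (hadj i hi))
    (fun i hi => (h2 (u i) (huB i hi)).2 T N hT1 hN hNL)
  refine le_trans (ENNReal.ofReal_le_ofReal (Real.exp_le_exp.2 ?_)) (hP.trans (measure_mono_ae ?_))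
  · have e1 : T / N * ∑ i ∈ Finset.range N, (lam (u i) + mu (u i)) ≤
        T * (v * (I + 2 * (δ / 3))) := by
      rw [div_mul_eq_mul_div, mul_div_assoc]
      exact mul_le_mul_of_nonneg_left hsum hT0.le
    -- This is the O(φ log φ) entropy of prescribing N = O(φ) jumps and holding times. The other two
    -- thirds of δ went to the scaling of the rates and the continuity of the power.
    have e2 : 2 * N * κ ≤ δ / 3 * (T * v) := by
      rw [div_lt_iff₀ hTv] at h4
      have hpos : 0 < 2 * L * (4 * K + 2) := by positivity
      calc 2 * N * κ ≤ 2 * (L * φ T) * κ := by gcongr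
        _ = (2 * L * (4 * K + 2)) * (φ T * Real.log (φ T)) := by rw [hκ]; ring
        _ ≤ (2 * L * (4 * K + 2)) * (δ / (3 * (2 * L * (4 * K + 2))) * (T * v)) := by gcongr
        _ = δ / 3 * (T * v) := by field_simp
    have e3 : T * (v * (I + 2 * (δ / 3))) = I * (T * v) + 2 * (δ / 3 * (T * v)) := by ring
    have e4 : (I + δ) * (T * v) = I * (T * v) + 3 * (δ / 3 * (T * v)) := by ring
    rw [e4]
    rw [e3] at e1
    linarith
  · filter_upwards [hξ] with ω h5 h6
    exact mem_tubeEvent_of_window h5 hT0 hN hθ0.le hθ1 hε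
      (fun i hi t ht hti => (hclose i hi t ht hti).trans hε1a) h6

/-! ### From probability bounds to the local large deviation principle. -/

/-- Exponential upper and lower bounds for the tube probabilities imply the local large deviation
principle. -/
theorem SatisfiesLLDP.of_bounds {Ω : Type*} [MeasurableSpace Ω] {P : Measure Ω}
    {ξ : ℝ → Ω → ℕ∞} {φ ψ : ℝ → ℝ} {I : (ℝ → ℝ) → ℝ} {F : Set (ℝ → ℝ)}
    (hψ : ∀ᶠ T in atTop, 0 < ψ T)
    (hup : ∀ f ∈ F, ∀ δ : ℝ, 0 < δ → ∀ᶠ ε in 𝓝[>] (0 : ℝ), ∀ᶠ T in atTop,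
      P (tubeEvent ξ φ T f ε) ≤ ENNReal.ofReal (Real.exp (-((I f - δ) * ψ T))))
    (hlow : ∀ f ∈ F, ∀ δ : ℝ, 0 < δ → ∀ ε : ℝ, 0 < ε → ∀ᶠ T in atTop,
      ENNReal.ofReal (Real.exp (-((I f + δ) * ψ T))) ≤ P (tubeEvent ξ φ T f ε)) :
    SatisfiesLLDP P ξ φ ψ I F := by
  intro f hf
  have hlogexp : ∀ r : ℝ, ENNReal.log (ENNReal.ofReal (Real.exp r)) = (r : EReal) := by
    intro r
    rw [ENNReal.log_ofReal_of_pos (Real.exp_pos r), Real.log_exp]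
  set A : ℝ → ℝ → EReal := fun ε T =>
    ENNReal.log (P (tubeEvent ξ φ T f ε)) / ((ψ T : ℝ) : EReal) with hA
  have hU : ∀ δ : ℝ, 0 < δ → ∀ᶠ ε in 𝓝[>] (0 : ℝ),
      limsup (A ε) atTop ≤ ((-(I f) + δ : ℝ) : EReal) := by
    intro δ hδ
    filter_upwards [hup f hf δ hδ] with ε hε
    refine limsup_le_of_le (h := ?_)
    filter_upwards [hε, hψ] with T h1 h2
    have h3 := ENNReal.log_monotone h1
    rw [hlogexp] at h3
    simp only [hA]
    rw [EReal.div_le_iff_le_mul (by exact_mod_cast h2) (EReal.coe_ne_top _), ← EReal.coe_mul]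
    refine h3.trans (EReal.coe_le_coe_iff.2 (le_of_eq (by ring)))
  have hL : ∀ δ : ℝ, 0 < δ → ∀ ε : ℝ, 0 < ε →
      ((-(I f) - δ : ℝ) : EReal) ≤ liminf (A ε) atTop := by
    intro δ hδ ε hε
    refine le_liminf_of_le (h := ?_)
    filter_upwards [hlow f hf δ hδ ε hε, hψ] with T h1 h2
    have h3 := ENNReal.log_monotone h1
    rw [hlogexp] at h3
    simp only [hA]
    rw [EReal.le_div_iff_mul_le (by exact_mod_cast h2) (EReal.coe_ne_top _), ← EReal.coe_mul]
    refine (EReal.coe_le_coe_iff.2 (le_of_eq (by ring))).trans h3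
  -- The lower bound holds for every ε > 0 and the upper one for small ε, so this comparison
  -- squeezes both limits.
  have hLU : ∀ ε, liminf (A ε) atTop ≤ limsup (A ε) atTop := fun ε => liminf_le_limsup
  have hpos : ∀ᶠ ε in 𝓝[>] (0 : ℝ), 0 < ε := eventually_mem_nhdsWithin
  have hgap_lt : ∀ a : EReal, a < ((-(I f) : ℝ) : EReal) →
      ∃ δ : ℝ, 0 < δ ∧ a < ((-(I f) - δ : ℝ) : EReal) := by
    intro a ha
    obtain ⟨r, hr1, hr2⟩ := EReal.lt_iff_exists_real_btwn.1 ha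
    have hr3 := EReal.coe_lt_coe_iff.1 hr2
    refine ⟨-(I f) - r, by linarith, ?_⟩
    rwa [sub_sub_cancel]
  have hgap_gt : ∀ a : EReal, ((-(I f) : ℝ) : EReal) < a →
      ∃ δ : ℝ, 0 < δ ∧ ((-(I f) + δ : ℝ) : EReal) < a := by
    intro a ha
    obtain ⟨r, hr1, hr2⟩ := EReal.lt_iff_exists_real_btwn.1 ha
    have hr3 := EReal.coe_lt_coe_iff.1 hr1
    refine ⟨r - -(I f), by linarith, ?_⟩
    rwa [add_sub_cancel]
  constructor
  · refine tendsto_order.2 ⟨fun a ha => ?_, fun a ha => ?_⟩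
    · obtain ⟨δ, hδ, h⟩ := hgap_lt a ha
      filter_upwards [hpos] with ε hε
      exact h.trans_le ((hL δ hδ ε hε).trans (hLU ε))
    · obtain ⟨δ, hδ, h⟩ := hgap_gt a ha
      filter_upwards [hU δ hδ] with ε hε using hε.trans_lt h
  · refine tendsto_order.2 ⟨fun a ha => ?_, fun a ha => ?_⟩
    · obtain ⟨δ, hδ, h⟩ := hgap_lt a ha
      filter_upwards [hpos] with ε hε
      exact h.trans_le (hL δ hδ ε hε)
    · obtain ⟨δ, hδ, h⟩ := hgap_gt a ha
      filter_upwards [hU δ hδ] with ε hε using (hLU ε).trans_lt (hε.trans_lt h)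

end BirthDeath

theorem theorem2p1 {Ω : Type*} [MeasurableSpace Ω] (P : Measure Ω) [IsProbabilityMeasure P]
    (lam mu : ℕ → ℝ) (hlam : ∀ x, 0 < lam x) (hmu0 : mu 0 = 0) (hmu : ∀ x, 1 ≤ x → 0 < mu x)
    (l m : ℝ) (hl : 0 ≤ l) (hm : 0 ≤ m) (hlm : l ≠ m)
    (y z : ℝ → ℝ) (hy : BirthDeath.SlowlyVarying y) (hz : BirthDeath.SlowlyVarying z)
    (hlamY : Tendsto (fun x : ℕ => lam x / BirthDeath.regVar y l (x : ℝ)) atTop (𝓝 1))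
    (hmuZ : Tendsto (fun x : ℕ => mu x / BirthDeath.regVar z m (x : ℝ)) atTop (𝓝 1))
    (V : ℝ → ℝ)
    (hV : ∀ x, V x = max (BirthDeath.regVar y l x) (BirthDeath.regVar z m x))
    (ξ : ℝ → Ω → ℕ∞) (hξ : BirthDeath.IsBirthDeathProcess P lam mu ξ)
    (φ : ℝ → ℝ) (hφpos : ∀ T, 0 < T → 0 < φ T) (hφ : Tendsto φ atTop atTop)
    (hφV : Tendsto (fun T : ℝ => φ T * Real.log (φ T) / (T * V (φ T))) atTop (𝓝 0)) :
    BirthDeath.SatisfiesLLDP P ξ φ (fun T => T * V (φ T))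
      (fun f => ∫ t in (0 : ℝ)..1, f t ^ max l m) BirthDeath.pathSet := by
  have hmu' : ∀ x, 0 ≤ mu x := fun x => by
    rcases Nat.eq_zero_or_pos x with h | h
    · rw [h, hmu0]
    · exact (hmu x h).le
  obtain ⟨X, S, hX, hS, hlaw, htraj⟩ := hξ
  have H : BirthDeath.JumpHoldLaw P lam mu X S := ⟨hX, hS, hlaw⟩
  have hξ' : ∀ᵐ ω ∂P, BirthDeath.IsTrajectory (fun i => X i ω) (fun i => S i ω)
      (fun t => ξ t ω) := by
    filter_upwards [htraj] with ω hω using ⟨hω.1, hω.2⟩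
  obtain ⟨a, ha, hVa, hqa, hG⟩ :=
    BirthDeath.total_rate_regVar hlam hmu' hlm hy hz hlamY hmuZ hV
  -- Two distinct nonnegative indices have a positive maximum; this makes V tend to infinity even if
  -- one index is 0.
  have hp : 0 < max l m := by
    rcases lt_or_gt_of_ne hlm with h | h
    · exact lt_max_of_lt_right (hl.trans_lt h)
    · exact lt_max_of_lt_left (hm.trans_lt h)
  have hq : ∀ n, 0 < lam n + mu n := fun n => add_pos_of_pos_of_nonneg (hlam n) (hmu' n)
  have hVinf : Tendsto V atTop atTop := (ha.regVar_tendsto_atTop hp).congr' hVa.symm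
  have hU : ∀ δ : ℝ, 0 < δ → ∀ b : ℝ, ∀ᶠ x in atTop, ∀ n : ℕ, (n : ℝ) ≤ b * x →
      |(lam n + mu n) / V x - (n / x) ^ max l m| ≤ δ := by
    intro δ hδ b
    filter_upwards [BirthDeath.rate_uniform ha hp hq hqa hδ b, hVa] with x hx hVx
    rw [hVx]
    exact hx
  obtain ⟨K₁, hK₁, hlogl⟩ := BirthDeath.abs_log_rate_le hy hlamY
  obtain ⟨K₂, hK₂, hlogm⟩ := BirthDeath.abs_log_rate_le hz hmuZ
  obtain ⟨K₃, hK₃, hlogq⟩ := BirthDeath.abs_log_rate_le ha hqa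
  have hlog : ∀ n : ℕ, 0 ≤ Real.log (n + 2) := fun n =>
    Real.log_nonneg (by linarith [n.cast_nonneg (α := ℝ)])
  -- The upper bound needs only φ = o(ψ), which follows since log φ ≥ 1 eventually.
  have hφV' : Tendsto (fun T : ℝ => φ T / (T * V (φ T))) atTop (𝓝 0) := by
    refine tendsto_of_tendsto_of_tendsto_of_le_of_le' tendsto_const_nhds hφV ?_ ?_
    · filter_upwards [(hVinf.comp hφ).eventually_ge_atTop 0, eventually_gt_atTop 0] with T h1 h2
      exact div_nonneg (hφpos T h2).le (mul_nonneg h2.le h1)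
    · filter_upwards [(hVinf.comp hφ).eventually_ge_atTop 0, eventually_gt_atTop 0,
        (Real.tendsto_log_atTop.comp hφ).eventually_ge_atTop 1] with T h1 h2 h3
      exact div_le_div_of_nonneg_right (le_mul_of_one_le_right (hφpos T h2).le h3)
        (mul_nonneg h2.le h1)
  refine BirthDeath.SatisfiesLLDP.of_bounds ?_ ?_ ?_
  · filter_upwards [(hVinf.comp hφ).eventually_gt_atTop 0, eventually_gt_atTop 0] with T h1 h2
    exact mul_pos h2 h1
  · intro f hf δ hδ
    exact BirthDeath.tubeEvent_upper_bound H hlam hmu' hmu0 hξ' hp hVinf hU hG hφ hφV' hf hδ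
  · intro f hf δ hδ ε hε
    exact BirthDeath.tubeEvent_lower_bound H hlam hmu' hmu0 hmu hξ' hp hVinf hU
      (K := K₁ + K₂ + K₃) (by positivity)
      (fun n => (hlogl n).trans (mul_le_mul_of_nonneg_right (by linarith) (hlog n)))
      (fun n => (hlogm n).trans (mul_le_mul_of_nonneg_right (by linarith) (hlog n)))
      (fun n => (hlogq n).trans (mul_le_mul_of_nonneg_right (by linarith) (hlog n)))
      hφ hφV hf hδ hε
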